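/- The following is a theorem of homotopy type theory, that is, of intensional Martin-Löf type theory with a cumulative hierarchy of universes $\mathcal U_0:\mathcal U_1:\cdots$, the type formers $\Pi,\Sigma,+,0,1,\mathbb N,=$, function extensionality, univalence, propositional truncation $\|{-}\|$ and nullification: for all universe levels $m,n$, the closed type expressing the statement below has a closed term. Notation. $\exists_{x:A}B(x)$ means $\|\sum_{x:A}B(x)\|$, and $\mathrm{Prop}$ is the type of propositions in $\mathcal U_n$. A collection of types is a function $T:I\to\mathcal U_n$ with $I:\mathcal U_m$ (it is small if $m\le n$ and large otherwise); $X\in T$ means $\exists_{i:I}\,T(i)=X$, and $\exists_{A\in T}Q(A)$ means $\exists_{i:I}Q(T(i))$. The collection $T$ is a presentation if $1\in T$ and if, for all $X:\mathcal U_n$ and $B:X\to\mathcal U_n$ with $X\in T$ and $B(x)\in T$ for every $x:X$, also $\sum_{x:X}B(x)\in T$. It is a projective presentation if moreover every $X\in T$ is projective: for every $B:X\to\mathcal U_{\max(m,n)}$, $\prod_{x:X}\|B(x)\|$ implies $\|\prod_{x:X}B(x)\|$. A type $Y$ is a $T$-sheaf if for every $i:I$ the diagonal map $Y\to(\|T(i)\|\to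 Y)$ is an equivalence. For a type $A$, its $T$-sheafification $\bigcirc_T A$ is the nullification of $A$ at the family $i\mapsto\|T(i)\|$: a $T$-sheaf with a map $\eta_A:A\to\bigcirc_T A$ such that, for every $T$-sheaf $Y$, precomposition $(\bigcirc_T A\to Y)\to(A\to Y)$ with $\eta_A$ is an equivalence. Theorem. Let $I:\mathcal U_m$ and let $T:I\to\mathcal U_n$ be a projective presentation. Then for every type $X:\mathcal U_n$ and every predicate $P:X\to\mathrm{Prop}$, $$\bigcirc_T\,\exists_{x:X}P(x)\;=\;\exists_{A\in T}\,\exists_{x:A\to X}\,\prod_{a:A}P(x(a))$$ as elements of $\mathcal U_{\max(m,n)}$. -/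

import Mathlib

/-! Homotopy type theory as a formal system: intensional Martin-Löf type theory with cumulative
Russell universes, dependent products (with eta), dependent sums, coproducts, empty type, unit type,
natural numbers, identity types, function extensionality, univalence, propositional truncation and
nullification.  A statement of homotopy type theory is a closed type, and it holds when that type
has a closed term. -/

namespace HoTT

/-- Raw terms, with de Bruijn indices.  The comments say how many variables an argument binds. -/
inductive Tm : Type
  | var (n : ℕ)
  | univ (i : ℕ)
  -- `B` and `b` bind one variable
  | pi (A B : Tm)
  | lam (A b : Tm)
  | app (f a : Tm)
  -- `B` and `C` bind one variable, `g` binds two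
  | sig (A B : Tm)
  | pair (a b : Tm)
  | indSig (C g p : Tm)
  -- `C`, `c`, `d` bind one variable
  | sum (A B : Tm)
  | inl (a : Tm)
  | inr (b : Tm)
  | indSum (C c d e : Tm)
  -- `C` binds one variable
  | empty
  | indEmpty (C e : Tm)
  -- `C` binds one variable
  | unit
  | star
  | indUnit (C c e : Tm)
  -- `C` binds one variable, `d` binds two
  | nat
  | zero
  | succ (a : Tm)
  | indNat (C c d e : Tm)
  -- `C` binds three variables, `c` binds one
  | id (A a b : Tm)
  | refl (a : Tm)
  | indId (C c a b p : Tm)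
  -- `B` binds one variable
  | funext (A B f g : Tm)
  | ua (i : ℕ) (A B : Tm)
  -- propositional truncation; nothing is bound
  | trunc (A : Tm)
  | tr (a : Tm)
  | squash (A x y : Tm)
  | recTrunc (A C h f x : Tm)
  -- nullification at the family `B` over `I`; `B` binds one variable
  | null (I B A : Tm)
  | nullUnit (I B A a : Tm)
  | nullIsNull (I B A : Tm)
  | nullRec (I B A Y h : Tm)

namespace Tm

/-- A renaming, carried under one binder. -/
def liftR (r : ℕ → ℕ) : ℕ → ℕ
  | 0 => 0
  | n + 1 => r n + 1

/-- Renaming of the free variables. -/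
def rename : (ℕ → ℕ) → Tm → Tm
  | r, var n => var (r n)
  | _, univ i => univ i
  | r, pi A B => pi (rename r A) (rename (liftR r) B)
  | r, lam A b => lam (rename r A) (rename (liftR r) b)
  | r, app f a => app (rename r f) (rename r a)
  | r, sig A B => sig (rename r A) (rename (liftR r) B)
  | r, pair a b => pair (rename r a) (rename r b)
  | r, indSig C g p =>
      indSig (rename (liftR r) C) (rename (liftR (liftR r)) g) (rename r p)
  | r, sum A B => sum (rename r A) (rename r B)
  | r, inl a => inl (rename r a)
  | r, inr b => inr (rename r b)
  | r, indSum C c d e =>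
      indSum (rename (liftR r) C) (rename (liftR r) c) (rename (liftR r) d) (rename r e)
  | _, empty => empty
  | r, indEmpty C e => indEmpty (rename (liftR r) C) (rename r e)
  | _, unit => unit
  | _, star => star
  | r, indUnit C c e => indUnit (rename (liftR r) C) (rename r c) (rename r e)
  | _, nat => nat
  | _, zero => zero
  | r, succ a => succ (rename r a)
  | r, indNat C c d e =>
      indNat (rename (liftR r) C) (rename r c) (rename (liftR (liftR r)) d) (rename r e)
  | r, id A a b => id (rename r A) (rename r a) (rename r b)
  | r, refl a => refl (rename r a)
  | r, indId C c a b p =>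
      indId (rename (liftR (liftR (liftR r))) C) (rename (liftR r) c)
        (rename r a) (rename r b) (rename r p)
  | r, funext A B f g =>
      funext (rename r A) (rename (liftR r) B) (rename r f) (rename r g)
  | r, ua i A B => ua i (rename r A) (rename r B)
  | r, trunc A => trunc (rename r A)
  | r, tr a => tr (rename r a)
  | r, squash A x y => squash (rename r A) (rename r x) (rename r y)
  | r, recTrunc A C h f x =>
      recTrunc (rename r A) (rename r C) (rename r h) (rename r f) (rename r x)
  | r, null I B A => null (rename r I) (rename (liftR r) B) (rename r A)
  | r, nullUnit I B A a =>
      nullUnit (rename r I) (rename (liftR r) B) (rename r A) (rename r a)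
  | r, nullIsNull I B A => nullIsNull (rename r I) (rename (liftR r) B) (rename r A)
  | r, nullRec I B A Y h =>
      nullRec (rename r I) (rename (liftR r) B) (rename r A) (rename r Y) (rename r h)

/-- Weakening by one variable. -/
def wk (t : Tm) : Tm := rename (fun n => n + 1) t

/-- Weakening by `k` variables. -/
def wkn (k : ℕ) (t : Tm) : Tm := rename (fun n => n + k) t

/-- Weakening by `k` variables of a term that lives under one further binder. -/
def wknUnder (k : ℕ) (t : Tm) : Tm := rename (liftR (fun n => n + k)) t

/-- A substitution, carried under one binder. -/
def liftS (s : ℕ → Tm) : ℕ → Tm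
  | 0 => var 0
  | n + 1 => wk (s n)

/-- Simultaneous capture-avoiding substitution. -/
def subst : (ℕ → Tm) → Tm → Tm
  | s, var n => s n
  | _, univ i => univ i
  | s, pi A B => pi (subst s A) (subst (liftS s) B)
  | s, lam A b => lam (subst s A) (subst (liftS s) b)
  | s, app f a => app (subst s f) (subst s a)
  | s, sig A B => sig (subst s A) (subst (liftS s) B)
  | s, pair a b => pair (subst s a) (subst s b)
  | s, indSig C g p =>
      indSig (subst (liftS s) C) (subst (liftS (liftS s)) g) (subst s p)
  | s, sum A B => sum (subst s A) (subst s B)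
  | s, inl a => inl (subst s a)
  | s, inr b => inr (subst s b)
  | s, indSum C c d e =>
      indSum (subst (liftS s) C) (subst (liftS s) c) (subst (liftS s) d) (subst s e)
  | _, empty => empty
  | s, indEmpty C e => indEmpty (subst (liftS s) C) (subst s e)
  | _, unit => unit
  | _, star => star
  | s, indUnit C c e => indUnit (subst (liftS s) C) (subst s c) (subst s e)
  | _, nat => nat
  | _, zero => zero
  | s, succ a => succ (subst s a)
  | s, indNat C c d e =>
      indNat (subst (liftS s) C) (subst s c) (subst (liftS (liftS s)) d) (subst s e)
  | s, id A a b => id (subst s A) (subst s a) (subst s b)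
  | s, refl a => refl (subst s a)
  | s, indId C c a b p =>
      indId (subst (liftS (liftS (liftS s))) C) (subst (liftS s) c)
        (subst s a) (subst s b) (subst s p)
  | s, funext A B f g =>
      funext (subst s A) (subst (liftS s) B) (subst s f) (subst s g)
  | s, ua i A B => ua i (subst s A) (subst s B)
  | s, trunc A => trunc (subst s A)
  | s, tr a => tr (subst s a)
  | s, squash A x y => squash (subst s A) (subst s x) (subst s y)
  | s, recTrunc A C h f x =>
      recTrunc (subst s A) (subst s C) (subst s h) (subst s f) (subst s x)
  | s, null I B A => null (subst s I) (subst (liftS s) B) (subst s A)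
  | s, nullUnit I B A a =>
      nullUnit (subst s I) (subst (liftS s) B) (subst s A) (subst s a)
  | s, nullIsNull I B A => nullIsNull (subst s I) (subst (liftS s) B) (subst s A)
  | s, nullRec I B A Y h =>
      nullRec (subst s I) (subst (liftS s) B) (subst s A) (subst s Y) (subst s h)

/-- The substitution that sends variable `0` to `a` and variable `n + 1` to `s n`. -/
def cons (a : Tm) (s : ℕ → Tm) : ℕ → Tm
  | 0 => a
  | n + 1 => s n

/-- The substitution that weakens by `k` variables. -/
def shift (k : ℕ) : ℕ → Tm := fun n => var (n + k)

/-- `B[a]`: substitute `a` for the last variable. -/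
def inst (B a : Tm) : Tm := subst (cons a var) B

/-! Type formers defined inside the theory. -/

/-- The function type `A → B`. -/
def arrow (A B : Tm) : Tm := pi A B.wk

/-- The product `A × B`. -/
def prod (A B : Tm) : Tm := sig A B.wk

/-- The first projection from a dependent sum over `A`. -/
def fst (A p : Tm) : Tm := indSig A.wk (var 1) p

/-- `Π x y : A, x = y`. -/
def isProp (A : Tm) : Tm := pi A (pi A.wk (id (A.wkn 2) (var 1) (var 0)))

/-- `f : A → B` is an equivalence:
`(Σ g : B → A, Π b, f (g b) = b) × (Σ h : B → A, Π a, h (f a) = a)`. -/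
def isEquiv (A B f : Tm) : Tm :=
  prod
    (sig (arrow B A)
      (pi B.wk (id (B.wkn 2) (app (f.wkn 2) (app (var 1) (var 0))) (var 0))))
    (sig (arrow B A)
      (pi A.wk (id (A.wkn 2) (app (var 1) (app (f.wkn 2) (var 0))) (var 0))))

/-- `A ≃ B`. -/
def eqv (A B : Tm) : Tm := sig (arrow A B) (isEquiv A.wk B.wk (var 0))

/-- The identity equivalence of `A`. -/
def idEqv (A : Tm) : Tm :=
  pair (lam A (var 0))
    (pair (pair (lam A (var 0)) (lam A (refl (var 0))))
      (pair (lam A (var 0)) (lam A (refl (var 0)))))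

/-- The canonical map `A = B → A ≃ B`, for `A B : univ i`. -/
def idToEqv (i : ℕ) (A B : Tm) : Tm :=
  lam (id (univ i) A B)
    (indId (eqv (var 2) (var 1)) (idEqv (var 0)) A.wk B.wk (var 0))

/-- The type `Π x : A, f x = g x`, for `f g : Π x : A, B`. -/
def homotopy (A B f g : Tm) : Tm :=
  pi A (id B (app f.wk (var 0)) (app g.wk (var 0)))

/-- The canonical map `f = g → Π x : A, f x = g x`, for `f g : Π x : A, B`. -/
def happly (A B f g : Tm) : Tm :=
  lam (id (pi A B) f g)
    (indId (homotopy (A.wkn 4) (B.wknUnder 4) (var 2) (var 1))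
      (lam (A.wkn 2) (refl (app (var 1) (var 0)))) f.wk g.wk (var 0))

/-- `Y` is null for the family `B` over `I`: for every `i : I` the diagonal map
`Y → (B i → Y)` is an equivalence.  Here `B` binds one variable. -/
def isNull (I B Y : Tm) : Tm :=
  pi I (isEquiv Y.wk (arrow B Y.wk) (lam Y.wk (lam B.wk (var 1))))

/-- Precomposition with the unit of nullification,
`(null I B A → Y) → (A → Y)`. -/
def precompUnit (I B A Y : Tm) : Tm :=
  lam (arrow (null I B A) Y)
    (lam A.wk (app (var 1) (nullUnit (I.wkn 2) (B.wknUnder 2) (A.wkn 2) (var 0))))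

end Tm

open Tm

/-- Contexts; the head of the list is the type of variable `0`. -/
abbrev Ctx : Type := List Tm

/-- The three forms of judgment: `Γ` is a context, `a : A` in context `Γ`, and `a ≡ b : A` in
context `Γ` (judgmental equality). -/
inductive Jdg : Type
  | ctx (Γ : Ctx)
  | tm (Γ : Ctx) (a A : Tm)
  | eq (Γ : Ctx) (a b A : Tm)

/-- Derivable judgments.  Types are the elements of the universes.  Congruence of judgmental
equality in arguments that bind nothing is an instance of `substCongr`; for term formers with
binders it is a rule. -/
inductive Der : Jdg → Prop
  -- contexts and structural rules
  | ctxNil : Der (.ctx [])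
  | ctxCons {Γ A i} : Der (.tm Γ A (univ i)) → Der (.ctx (A :: Γ))
  | varZero {Γ A} : Der (.ctx (A :: Γ)) → Der (.tm (A :: Γ) (var 0) A.wk)
  | wkTm {Γ A a B} : Der (.ctx (A :: Γ)) → Der (.tm Γ a B) → Der (.tm (A :: Γ) a.wk B.wk)
  | wkEq {Γ A a b B} :
      Der (.ctx (A :: Γ)) → Der (.eq Γ a b B) → Der (.eq (A :: Γ) a.wk b.wk B.wk)
  | substTm {Γ A a b B} :
      Der (.tm Γ a A) → Der (.tm (A :: Γ) b B) → Der (.tm Γ (b.inst a) (B.inst a))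
  | substEq {Γ A a b c B} :
      Der (.tm Γ a A) → Der (.eq (A :: Γ) b c B) →
      Der (.eq Γ (b.inst a) (c.inst a) (B.inst a))
  | substCongr {Γ A a a' b B} :
      Der (.eq Γ a a' A) → Der (.tm (A :: Γ) b B) →
      Der (.eq Γ (b.inst a) (b.inst a') (B.inst a))
  -- judgmental equality
  | eqRefl {Γ a A} : Der (.tm Γ a A) → Der (.eq Γ a a A)
  | eqSymm {Γ a b A} : Der (.eq Γ a b A) → Der (.eq Γ b a A)
  | eqTrans {Γ a b c A} : Der (.eq Γ a b A) → Der (.eq Γ b c A) → Der (.eq Γ a c A)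
  | convTm {Γ a A B i} : Der (.tm Γ a A) → Der (.eq Γ A B (univ i)) → Der (.tm Γ a B)
  | convEq {Γ a b A B i} :
      Der (.eq Γ a b A) → Der (.eq Γ A B (univ i)) → Der (.eq Γ a b B)
  -- universes
  | univ {Γ i} : Der (.ctx Γ) → Der (.tm Γ (univ i) (univ (i + 1)))
  | cumul {Γ A i} : Der (.tm Γ A (univ i)) → Der (.tm Γ A (univ (i + 1)))
  | cumulEq {Γ A B i} : Der (.eq Γ A B (univ i)) → Der (.eq Γ A B (univ (i + 1)))
  -- dependent products
  | pi {Γ A B i} :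
      Der (.tm Γ A (univ i)) → Der (.tm (A :: Γ) B (univ i)) → Der (.tm Γ (pi A B) (univ i))
  | piCongr {Γ A A' B B' i} :
      Der (.eq Γ A A' (univ i)) → Der (.eq (A :: Γ) B B' (univ i)) →
      Der (.eq Γ (pi A B) (pi A' B') (univ i))
  | lam {Γ A b B} : Der (.tm (A :: Γ) b B) → Der (.tm Γ (lam A b) (pi A B))
  | lamCongr {Γ A A' b b' B i} :
      Der (.eq Γ A A' (univ i)) → Der (.eq (A :: Γ) b b' B) →
      Der (.eq Γ (lam A b) (lam A' b') (pi A B))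
  | app {Γ A B f a} :
      Der (.tm Γ f (pi A B)) → Der (.tm Γ a A) → Der (.tm Γ (app f a) (B.inst a))
  | piBeta {Γ A B b a} :
      Der (.tm (A :: Γ) b B) → Der (.tm Γ a A) →
      Der (.eq Γ (app (lam A b) a) (b.inst a) (B.inst a))
  | piEta {Γ A B f} :
      Der (.tm Γ f (pi A B)) → Der (.eq Γ f (lam A (app f.wk (var 0))) (pi A B))
  -- dependent sums
  | sig {Γ A B i} :
      Der (.tm Γ A (univ i)) → Der (.tm (A :: Γ) B (univ i)) → Der (.tm Γ (sig A B) (univ i))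
  | sigCongr {Γ A A' B B' i} :
      Der (.eq Γ A A' (univ i)) → Der (.eq (A :: Γ) B B' (univ i)) →
      Der (.eq Γ (sig A B) (sig A' B') (univ i))
  | pair {Γ A B a b i} :
      Der (.tm (A :: Γ) B (univ i)) → Der (.tm Γ a A) → Der (.tm Γ b (B.inst a)) →
      Der (.tm Γ (pair a b) (sig A B))
  | indSig {Γ A B C g p i} :
      Der (.tm (sig A B :: Γ) C (univ i)) →
      Der (.tm (B :: A :: Γ) g (C.subst (cons (pair (var 1) (var 0)) (shift 2)))) →
      Der (.tm Γ p (sig A B)) → Der (.tm Γ (indSig C g p) (C.inst p))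
  | indSigCongr {Γ A B C C' g g' p p' i} :
      Der (.eq (sig A B :: Γ) C C' (univ i)) →
      Der (.eq (B :: A :: Γ) g g' (C.subst (cons (pair (var 1) (var 0)) (shift 2)))) →
      Der (.eq Γ p p' (sig A B)) → Der (.eq Γ (indSig C g p) (indSig C' g' p') (C.inst p))
  | sigBeta {Γ A B C g a b i} :
      Der (.tm (sig A B :: Γ) C (univ i)) →
      Der (.tm (B :: A :: Γ) g (C.subst (cons (pair (var 1) (var 0)) (shift 2)))) →
      Der (.tm Γ a A) → Der (.tm Γ b (B.inst a)) →
      Der (.eq Γ (indSig C g (pair a b)) (g.subst (cons b (cons a var))) (C.inst (pair a b)))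
  -- coproducts
  | sum {Γ A B i} :
      Der (.tm Γ A (univ i)) → Der (.tm Γ B (univ i)) → Der (.tm Γ (sum A B) (univ i))
  | inl {Γ A B a i} :
      Der (.tm Γ A (univ i)) → Der (.tm Γ B (univ i)) → Der (.tm Γ a A) →
      Der (.tm Γ (inl a) (sum A B))
  | inr {Γ A B b i} :
      Der (.tm Γ A (univ i)) → Der (.tm Γ B (univ i)) → Der (.tm Γ b B) →
      Der (.tm Γ (inr b) (sum A B))
  | indSum {Γ A B C c d e i} :
      Der (.tm (sum A B :: Γ) C (univ i)) →
      Der (.tm (A :: Γ) c (C.subst (cons (inl (var 0)) (shift 1)))) →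
      Der (.tm (B :: Γ) d (C.subst (cons (inr (var 0)) (shift 1)))) →
      Der (.tm Γ e (sum A B)) → Der (.tm Γ (indSum C c d e) (C.inst e))
  | indSumCongr {Γ A B C C' c c' d d' e e' i} :
      Der (.eq (sum A B :: Γ) C C' (univ i)) →
      Der (.eq (A :: Γ) c c' (C.subst (cons (inl (var 0)) (shift 1)))) →
      Der (.eq (B :: Γ) d d' (C.subst (cons (inr (var 0)) (shift 1)))) →
      Der (.eq Γ e e' (sum A B)) →
      Der (.eq Γ (indSum C c d e) (indSum C' c' d' e') (C.inst e))
  | inlBeta {Γ A B C c d a i} :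
      Der (.tm (sum A B :: Γ) C (univ i)) →
      Der (.tm (A :: Γ) c (C.subst (cons (inl (var 0)) (shift 1)))) →
      Der (.tm (B :: Γ) d (C.subst (cons (inr (var 0)) (shift 1)))) →
      Der (.tm Γ a A) → Der (.eq Γ (indSum C c d (inl a)) (c.inst a) (C.inst (inl a)))
  | inrBeta {Γ A B C c d b i} :
      Der (.tm (sum A B :: Γ) C (univ i)) →
      Der (.tm (A :: Γ) c (C.subst (cons (inl (var 0)) (shift 1)))) →
      Der (.tm (B :: Γ) d (C.subst (cons (inr (var 0)) (shift 1)))) →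
      Der (.tm Γ b B) → Der (.eq Γ (indSum C c d (inr b)) (d.inst b) (C.inst (inr b)))
  -- the empty type
  | empty {Γ i} : Der (.ctx Γ) → Der (.tm Γ empty (univ i))
  | indEmpty {Γ C e i} :
      Der (.tm (empty :: Γ) C (univ i)) → Der (.tm Γ e empty) →
      Der (.tm Γ (indEmpty C e) (C.inst e))
  | indEmptyCongr {Γ C C' e e' i} :
      Der (.eq (empty :: Γ) C C' (univ i)) → Der (.eq Γ e e' empty) →
      Der (.eq Γ (indEmpty C e) (indEmpty C' e') (C.inst e))
  -- the unit type
  | unit {Γ i} : Der (.ctx Γ) → Der (.tm Γ unit (univ i))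
  | star {Γ} : Der (.ctx Γ) → Der (.tm Γ star unit)
  | indUnit {Γ C c e i} :
      Der (.tm (unit :: Γ) C (univ i)) → Der (.tm Γ c (C.inst star)) → Der (.tm Γ e unit) →
      Der (.tm Γ (indUnit C c e) (C.inst e))
  | indUnitCongr {Γ C C' c c' e e' i} :
      Der (.eq (unit :: Γ) C C' (univ i)) → Der (.eq Γ c c' (C.inst star)) →
      Der (.eq Γ e e' unit) → Der (.eq Γ (indUnit C c e) (indUnit C' c' e') (C.inst e))
  | unitBeta {Γ C c i} :
      Der (.tm (unit :: Γ) C (univ i)) → Der (.tm Γ c (C.inst star)) →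
      Der (.eq Γ (indUnit C c star) c (C.inst star))
  -- natural numbers
  | nat {Γ i} : Der (.ctx Γ) → Der (.tm Γ nat (univ i))
  | zero {Γ} : Der (.ctx Γ) → Der (.tm Γ zero nat)
  | succ {Γ a} : Der (.tm Γ a nat) → Der (.tm Γ (succ a) nat)
  | indNat {Γ C c d e i} :
      Der (.tm (nat :: Γ) C (univ i)) → Der (.tm Γ c (C.inst zero)) →
      Der (.tm (C :: nat :: Γ) d (C.subst (cons (succ (var 1)) (shift 2)))) →
      Der (.tm Γ e nat) → Der (.tm Γ (indNat C c d e) (C.inst e))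
  | indNatCongr {Γ C C' c c' d d' e e' i} :
      Der (.eq (nat :: Γ) C C' (univ i)) → Der (.eq Γ c c' (C.inst zero)) →
      Der (.eq (C :: nat :: Γ) d d' (C.subst (cons (succ (var 1)) (shift 2)))) →
      Der (.eq Γ e e' nat) → Der (.eq Γ (indNat C c d e) (indNat C' c' d' e') (C.inst e))
  | zeroBeta {Γ C c d i} :
      Der (.tm (nat :: Γ) C (univ i)) → Der (.tm Γ c (C.inst zero)) →
      Der (.tm (C :: nat :: Γ) d (C.subst (cons (succ (var 1)) (shift 2)))) →
      Der (.eq Γ (indNat C c d zero) c (C.inst zero))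
  | succBeta {Γ C c d e i} :
      Der (.tm (nat :: Γ) C (univ i)) → Der (.tm Γ c (C.inst zero)) →
      Der (.tm (C :: nat :: Γ) d (C.subst (cons (succ (var 1)) (shift 2)))) →
      Der (.tm Γ e nat) →
      Der (.eq Γ (indNat C c d (succ e)) (d.subst (cons (indNat C c d e) (cons e var)))
        (C.inst (succ e)))
  -- identity types
  | id {Γ A a b i} :
      Der (.tm Γ A (univ i)) → Der (.tm Γ a A) → Der (.tm Γ b A) →
      Der (.tm Γ (id A a b) (univ i))
  | refl {Γ A a i} :
      Der (.tm Γ A (univ i)) → Der (.tm Γ a A) → Der (.tm Γ (refl a) (id A a a))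
  | indId {Γ A C c a b p i} :
      Der (.tm (id (A.wkn 2) (var 1) (var 0) :: A.wk :: A :: Γ) C (univ i)) →
      Der (.tm (A :: Γ) c
        (C.subst (cons (refl (var 0)) (cons (var 0) (cons (var 0) (shift 1)))))) →
      Der (.tm Γ a A) → Der (.tm Γ b A) → Der (.tm Γ p (id A a b)) →
      Der (.tm Γ (indId C c a b p) (C.subst (cons p (cons b (cons a var)))))
  | indIdCongr {Γ A C C' c c' a a' b b' p p' i} :
      Der (.eq (id (A.wkn 2) (var 1) (var 0) :: A.wk :: A :: Γ) C C' (univ i)) →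
      Der (.eq (A :: Γ) c c'
        (C.subst (cons (refl (var 0)) (cons (var 0) (cons (var 0) (shift 1)))))) →
      Der (.eq Γ a a' A) → Der (.eq Γ b b' A) → Der (.eq Γ p p' (id A a b)) →
      Der (.eq Γ (indId C c a b p) (indId C' c' a' b' p')
        (C.subst (cons p (cons b (cons a var)))))
  | idBeta {Γ A C c a i} :
      Der (.tm (id (A.wkn 2) (var 1) (var 0) :: A.wk :: A :: Γ) C (univ i)) →
      Der (.tm (A :: Γ) c
        (C.subst (cons (refl (var 0)) (cons (var 0) (cons (var 0) (shift 1)))))) →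
      Der (.tm Γ a A) →
      Der (.eq Γ (indId C c a a (refl a)) (c.inst a)
        (C.subst (cons (refl a) (cons a (cons a var)))))
  -- function extensionality and univalence
  | funext {Γ A B f g i} :
      Der (.tm Γ A (univ i)) → Der (.tm (A :: Γ) B (univ i)) →
      Der (.tm Γ f (pi A B)) → Der (.tm Γ g (pi A B)) →
      Der (.tm Γ (funext A B f g)
        (isEquiv (id (pi A B) f g) (homotopy A B f g) (happly A B f g)))
  | funextCongr {Γ A A' B B' f f' g g' i} :
      Der (.eq Γ A A' (univ i)) → Der (.eq (A :: Γ) B B' (univ i)) →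
      Der (.eq Γ f f' (pi A B)) → Der (.eq Γ g g' (pi A B)) →
      Der (.eq Γ (funext A B f g) (funext A' B' f' g')
        (isEquiv (id (pi A B) f g) (homotopy A B f g) (happly A B f g)))
  | ua {Γ A B i} :
      Der (.tm Γ A (univ i)) → Der (.tm Γ B (univ i)) →
      Der (.tm Γ (ua i A B) (isEquiv (id (univ i) A B) (eqv A B) (idToEqv i A B)))
  -- propositional truncation
  | trunc {Γ A i} : Der (.tm Γ A (univ i)) → Der (.tm Γ (trunc A) (univ i))
  | tr {Γ A a i} :
      Der (.tm Γ A (univ i)) → Der (.tm Γ a A) → Der (.tm Γ (tr a) (trunc A))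
  | squash {Γ A x y i} :
      Der (.tm Γ A (univ i)) → Der (.tm Γ x (trunc A)) → Der (.tm Γ y (trunc A)) →
      Der (.tm Γ (squash A x y) (id (trunc A) x y))
  | recTrunc {Γ A C h f x i j} :
      Der (.tm Γ A (univ i)) → Der (.tm Γ C (univ j)) →
      Der (.tm Γ h (isProp C)) → Der (.tm Γ f (arrow A C)) → Der (.tm Γ x (trunc A)) →
      Der (.tm Γ (recTrunc A C h f x) C)
  | truncBeta {Γ A C h f a i j} :
      Der (.tm Γ A (univ i)) → Der (.tm Γ C (univ j)) →
      Der (.tm Γ h (isProp C)) → Der (.tm Γ f (arrow A C)) → Der (.tm Γ a A) →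
      Der (.eq Γ (recTrunc A C h f (tr a)) (app f a) C)
  -- nullification of `A` at the family `B` over `I`: a null type with a unit `A → null I B A`
  -- such that precomposition with the unit is an equivalence for every null type `Y`
  | null {Γ I B A i} :
      Der (.tm Γ I (univ i)) → Der (.tm (I :: Γ) B (univ i)) → Der (.tm Γ A (univ i)) →
      Der (.tm Γ (null I B A) (univ i))
  | nullCongr {Γ I I' B B' A A' i} :
      Der (.eq Γ I I' (univ i)) → Der (.eq (I :: Γ) B B' (univ i)) →
      Der (.eq Γ A A' (univ i)) → Der (.eq Γ (null I B A) (null I' B' A') (univ i))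
  | nullUnit {Γ I B A a i} :
      Der (.tm Γ I (univ i)) → Der (.tm (I :: Γ) B (univ i)) → Der (.tm Γ A (univ i)) →
      Der (.tm Γ a A) → Der (.tm Γ (nullUnit I B A a) (null I B A))
  | nullUnitCongr {Γ I I' B B' A A' a a' i} :
      Der (.eq Γ I I' (univ i)) → Der (.eq (I :: Γ) B B' (univ i)) →
      Der (.eq Γ A A' (univ i)) → Der (.eq Γ a a' A) →
      Der (.eq Γ (nullUnit I B A a) (nullUnit I' B' A' a') (null I B A))
  | nullIsNull {Γ I B A i} :
      Der (.tm Γ I (univ i)) → Der (.tm (I :: Γ) B (univ i)) → Der (.tm Γ A (univ i)) →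
      Der (.tm Γ (nullIsNull I B A) (isNull I B (null I B A)))
  | nullIsNullCongr {Γ I I' B B' A A' i} :
      Der (.eq Γ I I' (univ i)) → Der (.eq (I :: Γ) B B' (univ i)) →
      Der (.eq Γ A A' (univ i)) →
      Der (.eq Γ (nullIsNull I B A) (nullIsNull I' B' A') (isNull I B (null I B A)))
  | nullRec {Γ I B A Y h i j} :
      Der (.tm Γ I (univ i)) → Der (.tm (I :: Γ) B (univ i)) → Der (.tm Γ A (univ i)) →
      Der (.tm Γ Y (univ j)) → Der (.tm Γ h (isNull I B Y)) →
      Der (.tm Γ (nullRec I B A Y h)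
        (isEquiv (arrow (null I B A) Y) (arrow A Y) (precompUnit I B A Y)))
  | nullRecCongr {Γ I I' B B' A A' Y Y' h h' i j} :
      Der (.eq Γ I I' (univ i)) → Der (.eq (I :: Γ) B B' (univ i)) →
      Der (.eq Γ A A' (univ i)) → Der (.eq Γ Y Y' (univ j)) →
      Der (.eq Γ h h' (isNull I B Y)) →
      Der (.eq Γ (nullRec I B A Y h) (nullRec I' B' A' Y' h')
        (isEquiv (arrow (null I B A) Y) (arrow A Y) (precompUnit I B A Y)))

/-- A closed type holds in homotopy type theory: it has a closed term. -/
def Holds (A : Tm) : Prop := ∃ t : Tm, Der (.tm [] t A)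

/-! Collections of types, presentations and sheafification, inside the theory.  A collection of
types is a term `T : I → univ n`. -/

namespace Tm

/-- `Prop`, the type of propositions of `univ n`. -/
def propU (n : ℕ) : Tm := sig (univ n) (isProp (var 0))

/-- The underlying type of `p : propU n`. -/
def holds (n : ℕ) (p : Tm) : Tm := fst (univ n) p

/-- `∃ x : A, B`, the propositional truncation of the dependent sum; `B` binds one variable. -/
def ex (A B : Tm) : Tm := trunc (sig A B)

/-- `X ∈ T`, that is `∃ i : I, T i = X`. -/
def mem (n : ℕ) (I T X : Tm) : Tm := ex I (id (univ n) (app T.wk (var 0)) X.wk)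

/-- `T` is a presentation: `1 ∈ T`, and for all `X : univ n` and `B : X → univ n`, if `X ∈ T` and
`B x ∈ T` for all `x : X`, then `(Σ x : X, B x) ∈ T`. -/
def isPresentation (n : ℕ) (I T : Tm) : Tm :=
  prod (mem n I T unit)
    (pi (univ n) (pi (arrow (var 0) (univ n))
      (arrow (mem n (I.wkn 2) (T.wkn 2) (var 1))
        (arrow (pi (var 1) (mem n (I.wkn 3) (T.wkn 3) (app (var 1) (var 0))))
          (mem n (I.wkn 2) (T.wkn 2) (sig (var 1) (app (var 1) (var 0))))))))

/-- `X` is projective: for every `B : X → univ l`, if `Π x : X, ‖B x‖` then `‖Π x : X, B x‖`. -/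
def isProjective (l : ℕ) (X : Tm) : Tm :=
  pi (arrow X (univ l))
    (arrow (pi X.wk (trunc (app (var 1) (var 0)))) (trunc (pi X.wk (app (var 1) (var 0)))))

/-- `T : I → univ n` with `I : univ m` is a projective presentation: a presentation such that
every `X ∈ T` is projective, with respect to families in `univ (max m n)`.  For a small collection
(`m ≤ n`, in particular `I : univ n`) this universe is `univ n` itself; for a large collection it is
the universe that contains the index type, the members of `T` and the sheafification. -/
def isProjPresentation (m n : ℕ) (I T : Tm) : Tm :=
  prod (isPresentation n I T)
    (pi (univ n) (arrow (mem n I.wk T.wk (var 0)) (isProjective (max m n) (var 0))))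

/-- The `T`-sheafification of `A`: its nullification at the family `‖T i‖`, `i : I`. -/
def sheafify (I T A : Tm) : Tm := null I (trunc (app T.wk (var 0))) A

/-- The Kripke–Joyal statement:
for all `I : univ m`, `T : I → univ n` a projective presentation, `X : univ n` and `P : X → Prop`,
the type `O_T (∃ x : X, P x)` equals the type `∃ i : I, ∃ x : T i → X, Π a : T i, P (x a)`. -/
def kripkeJoyal (m n : ℕ) : Tm :=
  -- `I`
  pi (univ m) <|
  -- `T`
  pi (arrow (var 0) (univ n)) <|
  -- the hypothesis on `T`; below it `I` is variable `2` and `T` is variable `1`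
  pi (isProjPresentation m n (var 1) (var 0)) <|
  -- `X`
  pi (univ n) <|
  -- `P`; below it `I`, `T`, `X`, `P` are the variables `4`, `3`, `1`, `0`
  pi (arrow (var 0) (propU n)) <|
  id (univ (max m n))
    (sheafify (var 4) (var 3) (ex (var 1) (holds n (app (var 1) (var 0)))))
    (ex (var 4)
      (ex (arrow (app (var 4) (var 0)) (var 2))
        (pi (app (var 5) (var 1)) (holds n (app (var 3) (app (var 1) (var 0)))))))

end Tm

end HoTT

/-! Write `S` for `Σ x : X, P x`, so that `∃ x, P x` is `‖S‖`, and let local existence be the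
proposition `∃ i : I, (T i → S)`. Both sides of the theorem are propositions, so by propositional
univalence maps in both directions suffice; they pass through local existence.

From the sheafification to local existence: since `1 ∈ T`, there is an index, and an element of `S`
gives a constant map out of the corresponding `T i`; so `‖S‖` implies local existence. By the
universal property it remains to see that local existence is a sheaf. Let it hold under `‖T i‖`.
Restriction to `T i` gives `Π a : T i, ‖Σ j, (T j → S)‖`, and projectivity of `T i` gives, merely, a
function choosing for each `a` an index `J a` and a map `T (J a) → S`. The total space `Σ a, T (J
a)` belongs to `T` by closure under sums, and the chosen maps combine to a map from it to `S`. This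
is the proof in `inh_localEx_of_fun` and `inh_localEx_of_cover`. The type `Σ j, (T j → S)` has the
level `max m n`, because it contains the index type; this fixes the universe in which projectivity
is required.

From local existence to the sheafification: given `T i → S`, the sheaf condition allows one to
assume `‖T i‖`. As `○‖S‖` is a proposition, an actual element of `T i` may be taken, and the unit
applied to its image. That `○A` is a proposition when `A` is one follows from the uniqueness of
extensions along the unit, used twice.

Finally, a map `A → Σ x, P x` amounts to a function `A → X` with a pointwise proof of `P`, which
turns local existence into the right-hand side.

All of this is carried out as derivations. `Inh` forgets the inhabiting term whenever only its
existence matters. Types are matched either syntactically, after normalising substitutions, or by an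
explicit judgmental conversion. -/

namespace HoTT

namespace Tm

/-! The algebra of substitutions. -/

/-- Composition of substitutions: first `s`, then `s'`. -/
def comp (s s' : ℕ → Tm) : ℕ → Tm := fun n => (s n).subst s'

theorem liftS_var_comp (r : ℕ → ℕ) :
    liftS (fun n => var (r n)) = fun n => var (liftR r n) := by
  funext n; cases n <;> rfl

/-- Treating renamings as substitutions by variables lets one calculus of substitutions serve for
weakening as well. -/
theorem rename_eq_subst (t : Tm) (r : ℕ → ℕ) : t.rename r = t.subst (fun n => var (r n)) := by
  induction t generalizing r <;> simp_all [rename, subst, liftS_var_comp]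

theorem liftS_comp_liftR (s : ℕ → Tm) (r : ℕ → ℕ) :
    (fun n => liftS s (liftR r n)) = liftS (fun n => s (r n)) := by
  funext n; cases n <;> rfl

theorem subst_rename (t : Tm) (r : ℕ → ℕ) (s : ℕ → Tm) :
    (t.rename r).subst s = t.subst (fun n => s (r n)) := by
  induction t generalizing r s <;> simp_all [rename, subst, liftS_comp_liftR]

theorem rename_wk (t : Tm) (r : ℕ → ℕ) : t.wk.rename (liftR r) = (t.rename r).wk := by
  simp only [wk, rename_eq_subst _ (liftR r), subst_rename, rename_eq_subst t r]
  rw [rename_eq_subst, ← rename_eq_subst t r, subst_rename]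
  rfl

theorem rename_comp_liftS (s : ℕ → Tm) (r : ℕ → ℕ) :
    (fun n => (liftS s n).rename (liftR r)) = liftS (fun n => (s n).rename r) := by
  funext n
  cases n with
  | zero => rfl
  | succ n => exact rename_wk (s n) r

theorem rename_subst (t : Tm) (s : ℕ → Tm) (r : ℕ → ℕ) :
    (t.subst s).rename r = t.subst (fun n => (s n).rename r) := by
  induction t generalizing r s <;> simp_all [rename, subst, rename_comp_liftS]

/-- Lifting a substitution weakens its values by a renaming, so this case needs both mixed laws
`subst_rename` and `rename_subst` before composition of substitutions is available. -/
theorem comp_liftS (s s' : ℕ → Tm) : comp (liftS s) (liftS s') = liftS (comp s s') := by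
  funext n
  cases n with
  | zero => rfl
  | succ n =>
    change (wk (s n)).subst (liftS s') = wk ((s n).subst s')
    rw [wk, wk, subst_rename, rename_subst]
    rfl

theorem liftS_var : liftS var = var := by
  funext n; cases n <;> rfl

@[simp] theorem subst_subst (t : Tm) (s s' : ℕ → Tm) :
    (t.subst s).subst s' = t.subst (comp s s') := by
  induction t generalizing s s' <;> simp_all [subst, comp_liftS]
  rfl

@[simp] theorem subst_var (t : Tm) : t.subst var = t := by
  induction t <;> simp_all [subst, liftS_var]

@[simp] theorem wk_eq (t : Tm) : t.wk = t.subst (shift 1) := rename_eq_subst t _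
@[simp] theorem wkn_eq (k : ℕ) (t : Tm) : t.wkn k = t.subst (shift k) := rename_eq_subst t _
@[simp] theorem inst_eq (B a : Tm) : B.inst a = B.subst (cons a var) := rfl

-- Eliminates lifting in favour of `cons`, `comp` and `shift`, the normal form used by `simp` from
-- here on.
@[simp] theorem liftS_eq (s : ℕ → Tm) : liftS s = cons (var 0) (comp s (shift 1)) := by
  funext n
  cases n with
  | zero => rfl
  | succ n => exact wk_eq (s n)

@[simp] theorem wknUnder_eq (k : ℕ) (t : Tm) :
    t.wknUnder k = t.subst (cons (var 0) (shift (k + 1))) := by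
  rw [wknUnder, rename_eq_subst]
  congr 1
  funext n; cases n <;> rfl

/-! ### The calculus of `cons`, `comp` and `shift` -/

@[simp] theorem shift_zero : shift 0 = var := rfl
theorem shift_apply (k n : ℕ) : shift k n = var (n + k) := rfl
@[simp] theorem cons_zero (a : Tm) (s : ℕ → Tm) : cons a s 0 = a := rfl
@[simp] theorem cons_one (a : Tm) (s : ℕ → Tm) : cons a s 1 = s 0 := rfl
@[simp] theorem cons_two (a : Tm) (s : ℕ → Tm) : cons a s 2 = s 1 := rfl
@[simp] theorem cons_three (a : Tm) (s : ℕ → Tm) : cons a s 3 = s 2 := rfl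
@[simp] theorem shift_zero_apply (k : ℕ) : shift k 0 = var k := by simp [shift_apply]
@[simp] theorem shift_two_apply (k : ℕ) : shift k 2 = var (2 + k) := rfl
@[simp] theorem shift_three_apply (k : ℕ) : shift k 3 = var (3 + k) := rfl
@[simp] theorem shift_four_apply (k : ℕ) : shift k 4 = var (4 + k) := rfl
@[simp] theorem shift_one_apply (k : ℕ) : shift k 1 = var (1 + k) := rfl
@[simp] theorem comp_apply (s s' : ℕ → Tm) (n : ℕ) : comp s s' n = (s n).subst s' := rfl

@[simp] theorem comp_var_left (s : ℕ → Tm) : comp var s = s := rfl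
@[simp] theorem comp_var_right (s : ℕ → Tm) : comp s var = s := by funext n; simp
@[simp] theorem comp_assoc (s s' s'' : ℕ → Tm) :
    comp (comp s s') s'' = comp s (comp s' s'') := by
  funext n; simp
@[simp] theorem comp_cons (a : Tm) (s s' : ℕ → Tm) :
    comp (cons a s) s' = cons (a.subst s') (comp s s') := by
  funext n; cases n <;> rfl
@[simp] theorem comp_shift_shift (j k : ℕ) : comp (shift j) (shift k) = shift (j + k) := by
  funext n; simp [shift_apply, subst, Nat.add_assoc]
@[simp] theorem comp_shift_succ_cons (k : ℕ) (a : Tm) (s : ℕ → Tm) :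
    comp (shift (k + 1)) (cons a s) = comp (shift k) s := by
  funext n; rfl
@[simp] theorem comp_shift_one_cons (a : Tm) (s : ℕ → Tm) :
    comp (shift 1) (cons a s) = s := by
  funext n; rfl
@[simp] theorem comp_shift_two_cons (a : Tm) (s : ℕ → Tm) :
    comp (shift 2) (cons a s) = comp (shift 1) s := by
  funext n; rfl
@[simp] theorem comp_shift_three_cons (a : Tm) (s : ℕ → Tm) :
    comp (shift 3) (cons a s) = comp (shift 2) s := by
  funext n; rfl
@[simp] theorem cons_var_zero : cons (var 0) (shift 1) = var := by
  funext n; cases n <;> rfl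

attribute [simp] subst

/-! ### Substitution in the defined type formers -/

@[simp] theorem subst_arrow (A B : Tm) (s : ℕ → Tm) :
    (arrow A B).subst s = arrow (A.subst s) (B.subst s) := by simp [arrow]
@[simp] theorem subst_prod (A B : Tm) (s : ℕ → Tm) :
    (prod A B).subst s = prod (A.subst s) (B.subst s) := by simp [prod]
@[simp] theorem subst_fst (A p : Tm) (s : ℕ → Tm) :
    (fst A p).subst s = fst (A.subst s) (p.subst s) := by simp [fst]
@[simp] theorem subst_isProp (A : Tm) (s : ℕ → Tm) :
    (isProp A).subst s = isProp (A.subst s) := by simp [isProp]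
@[simp] theorem subst_isEquiv (A B f : Tm) (s : ℕ → Tm) :
    (isEquiv A B f).subst s = isEquiv (A.subst s) (B.subst s) (f.subst s) := by simp [isEquiv]
@[simp] theorem subst_eqv (A B : Tm) (s : ℕ → Tm) :
    (eqv A B).subst s = eqv (A.subst s) (B.subst s) := by simp [eqv]
@[simp] theorem subst_homotopy (A B f g : Tm) (s : ℕ → Tm) :
    (homotopy A B f g).subst s =
      homotopy (A.subst s) (B.subst (liftS s)) (f.subst s) (g.subst s) := by simp [homotopy]
@[simp] theorem subst_precompUnit (I B A Y : Tm) (s : ℕ → Tm) :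
    (precompUnit I B A Y).subst s =
      precompUnit (I.subst s) (B.subst (liftS s)) (A.subst s) (Y.subst s) := by
  simp [precompUnit]
@[simp] theorem subst_propU (n : ℕ) (s : ℕ → Tm) : (propU n).subst s = propU n := by
  simp [propU]
@[simp] theorem subst_holds (n : ℕ) (p : Tm) (s : ℕ → Tm) :
    (holds n p).subst s = holds n (p.subst s) := by simp [holds]
@[simp] theorem subst_ex (A B : Tm) (s : ℕ → Tm) :
    (ex A B).subst s = ex (A.subst s) (B.subst (liftS s)) := by simp [ex]
@[simp] theorem subst_mem (n : ℕ) (I T X : Tm) (s : ℕ → Tm) :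
    (mem n I T X).subst s = mem n (I.subst s) (T.subst s) (X.subst s) := by simp [mem]
@[simp] theorem subst_isProjective (l : ℕ) (X : Tm) (s : ℕ → Tm) :
    (isProjective l X).subst s = isProjective l (X.subst s) := by simp [isProjective]
@[simp] theorem subst_isPresentation (n : ℕ) (I T : Tm) (s : ℕ → Tm) :
    (isPresentation n I T).subst s = isPresentation n (I.subst s) (T.subst s) := by
  simp [isPresentation]
@[simp] theorem subst_isProjPresentation (m n : ℕ) (I T : Tm) (s : ℕ → Tm) :
    (isProjPresentation m n I T).subst s = isProjPresentation m n (I.subst s) (T.subst s) := by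
  simp [isProjPresentation]
@[simp] theorem subst_sheafify (I T A : Tm) (s : ℕ → Tm) :
    (sheafify I T A).subst s = sheafify (I.subst s) (T.subst s) (A.subst s) := by
  simp [sheafify]

end Tm

open Tm

/-! Structural rules and simple type formers. -/

/-- `A` is a type of level `i`. -/
abbrev Ty (Γ : Ctx) (A : Tm) (i : ℕ) : Prop := Der (.tm Γ A (univ i))

/-- `A` has an element in context `Γ`. -/
def Inh (Γ : Ctx) (A : Tm) : Prop := ∃ t, Der (.tm Γ t A)

/-- The context of a judgment. -/
def Jdg.context : Jdg → Ctx
  | .ctx Γ => Γ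
  | .tm Γ _ _ => Γ
  | .eq Γ _ _ _ => Γ

/-- Quantifying over all suffixes makes the induction work: a rule such as `lam` has its only
premise in an extended context, of which the context of the conclusion is a suffix. -/
theorem Der.ctx_of_suffix {J : Jdg} (h : Der J) :
    ∀ Δ, Δ <:+ J.context → Der (.ctx Δ) := by
  induction h with
  | ctxNil => intro Δ hΔ; simp only [Jdg.context, List.suffix_nil] at hΔ; exact hΔ ▸ .ctxNil
  | ctxCons h ih =>
    intro Δ hΔ
    rcases List.suffix_cons_iff.1 hΔ with rfl | hΔ
    · exact .ctxCons h
    · exact ih Δ hΔ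
  | _ =>
    intro Δ hΔ
    simp only [Jdg.context] at *
    first
    | solve_by_elim
    | exact (by assumption : ∀ Δ, Δ <:+ _ :: _ → Der (.ctx Δ)) Δ
        (hΔ.trans (List.suffix_cons _ _))

theorem ctx_of_der {Γ : Ctx} {a A : Tm} (h : Der (.tm Γ a A)) : Der (.ctx Γ) :=
  h.ctx_of_suffix Γ (List.suffix_refl Γ)

section structural

variable {Γ : Ctx} {A B C D a b c f g p t u : Tm} {i j k : ℕ}

theorem ty_of_le (h : i ≤ j) (hA : Ty Γ A i) : Ty Γ A j := by
  induction h with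
  | refl => exact hA
  | step _ ih => exact .cumul ih

theorem der_wk (hA : Ty Γ A i) (h : Der (.tm Γ a B)) :
    Der (.tm (A :: Γ) (a.subst (shift 1)) (B.subst (shift 1))) := by
  simpa using Der.wkTm (.ctxCons hA) h

theorem ty_wk (hA : Ty Γ A i) (h : Ty Γ B j) : Ty (A :: Γ) (B.subst (shift 1)) j := der_wk hA h

theorem inh_wk (hA : Ty Γ A i) (h : Inh Γ B) : Inh (A :: Γ) (B.subst (shift 1)) :=
  h.imp' _ fun _ ht => der_wk hA ht

theorem der_wk_two (hA : Ty Γ A i) (hB : Ty (A :: Γ) B j) (h : Der (.tm Γ a C)) :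
    Der (.tm (B :: A :: Γ) (a.subst (shift 2)) (C.subst (shift 2))) := by
  simpa using der_wk hB (der_wk hA h)

theorem ty_wk_two (hA : Ty Γ A i) (hB : Ty (A :: Γ) B j) (h : Ty Γ C k) :
    Ty (B :: A :: Γ) (C.subst (shift 2)) k := der_wk_two hA hB h

theorem inh_wk_two (hA : Ty Γ A i) (hB : Ty (A :: Γ) B j) (h : Inh Γ C) :
    Inh (B :: A :: Γ) (C.subst (shift 2)) := by
  simpa using inh_wk hB (inh_wk hA h)

theorem der_var_zero (hA : Ty Γ A i) : Der (.tm (A :: Γ) (var 0) (A.subst (shift 1))) := by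
  simpa using Der.varZero (.ctxCons hA)

theorem der_var_one (hA : Ty Γ A i) (hB : Ty (A :: Γ) B j) :
    Der (.tm (B :: A :: Γ) (var 1) (A.subst (shift 2))) := by
  simpa using der_wk hB (der_var_zero hA)

theorem inh_conv (h : Inh Γ A) (e : Der (.eq Γ A B (univ i))) : Inh Γ B :=
  h.imp fun _ ht => .convTm ht e

theorem ty_univ (hA : Ty Γ A i) : Ty (A :: Γ) (univ j) (j + 1) := .univ (.ctxCons hA)

/-! Functions. -/

theorem ty_arrow (hA : Ty Γ A i) (hB : Ty Γ B i) : Ty Γ (arrow A B) i :=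
  .pi hA (.wkTm (.ctxCons hA) hB)

theorem der_lam (h : Der (.tm (A :: Γ) b (B.subst (shift 1)))) :
    Der (.tm Γ (lam A b) (arrow A B)) := by
  refine Der.lam ?_
  simpa using h

theorem der_app_pi (hf : Der (.tm Γ f (pi A B))) (ha : Der (.tm Γ a A))
    (e : C = B.subst (cons a var)) : Der (.tm Γ (app f a) C) := e ▸ Der.app hf ha

theorem der_app (hf : Der (.tm Γ f (arrow A B))) (ha : Der (.tm Γ a A)) :
    Der (.tm Γ (app f a) B) := der_app_pi hf ha (by simp)

theorem inh_pi (h : Inh (A :: Γ) B) : Inh Γ (pi A B) := h.imp' _ fun _ ht => .lam ht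

theorem inh_arrow (h : Inh (A :: Γ) (B.subst (shift 1))) : Inh Γ (arrow A B) :=
  h.imp' _ fun _ ht => der_lam ht

theorem inh_app_pi (hf : Inh Γ (pi A B)) (ha : Der (.tm Γ a A)) :
    Inh Γ (B.subst (cons a var)) := hf.imp' _ fun _ ht => .app ht ha

theorem inh_app (hf : Inh Γ (arrow A B)) (ha : Inh Γ A) : Inh Γ B := by
  obtain ⟨f, hf⟩ := hf
  obtain ⟨a, ha⟩ := ha
  exact ⟨_, der_app hf ha⟩

theorem eq_beta (hb : Der (.tm (A :: Γ) b (B.subst (shift 1)))) (ha : Der (.tm Γ a A)) :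
    Der (.eq Γ (app (lam A b) a) (b.subst (cons a var)) B) := by
  simpa using Der.piBeta hb ha

theorem eq_app_arg (hA : Ty Γ A i) (hf : Der (.tm Γ f (arrow A B)))
    (e : Der (.eq Γ a b A)) : Der (.eq Γ (app f a) (app f b) B) := by
  have h := der_wk hA hf
  rw [subst_arrow] at h
  simpa using Der.substCongr e (der_app h (der_var_zero hA))

/-! Dependent sums. -/

theorem ty_prod (hA : Ty Γ A i) (hB : Ty Γ B i) : Ty Γ (prod A B) i :=
  .sig hA (.wkTm (.ctxCons hA) hB)

theorem der_pair_prod (hA : Ty Γ A i) (hB : Ty Γ B j) (ha : Der (.tm Γ a A))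
    (hb : Der (.tm Γ b B)) : Der (.tm Γ (pair a b) (prod A B)) :=
  .pair (i := j) (.wkTm (.ctxCons hA) hB) ha (by simpa using hb)

theorem der_fst (hA : Ty Γ A i) (hB : Ty (A :: Γ) B i) (hp : Der (.tm Γ p (sig A B))) :
    Der (.tm Γ (fst A p) A) := by
  have h := Der.indSig (C := A.wk) (g := var 1) (i := i)
    (by simpa using ty_wk (.sig hA hB) hA) (by simpa using der_var_one hA hB) hp
  simpa [fst] using h

theorem eq_fst (hA : Ty Γ A i) (hB : Ty (A :: Γ) B i) (ha : Der (.tm Γ a A))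
    (hb : Der (.tm Γ b (B.subst (cons a var)))) :
    Der (.eq Γ (fst A (pair a b)) a A) := by
  have h := Der.sigBeta (C := A.wk) (g := var 1) (i := i)
    (by simpa using ty_wk (.sig hA hB) hA) (by simpa using der_var_one hA hB) ha hb
  simpa [fst] using h

theorem der_sig_elim (hA : Ty Γ A i) (hB : Ty (A :: Γ) B i) (hC : Ty Γ C j)
    (hg : Der (.tm (B :: A :: Γ) g (C.subst (shift 2)))) (hp : Der (.tm Γ p (sig A B))) :
    Der (.tm Γ (indSig C.wk g p) C) := by
  have h := Der.indSig (C := C.wk) (g := g) (i := j)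
    (by simpa using ty_wk (.sig hA hB) hC) (by simpa using hg) hp
  simpa using h

theorem inh_sig_elim (hA : Ty Γ A i) (hB : Ty (A :: Γ) B i) (hC : Ty Γ C j)
    (hp : Inh Γ (sig A B)) (hg : Inh (B :: A :: Γ) (C.subst (shift 2))) : Inh Γ C := by
  obtain ⟨p, hp⟩ := hp
  obtain ⟨g, hg⟩ := hg
  exact ⟨_, der_sig_elim hA hB hC hg hp⟩

theorem inh_fst (hA : Ty Γ A i) (hB : Ty (A :: Γ) B i) (hp : Inh Γ (sig A B)) : Inh Γ A :=
  hp.imp' _ fun _ h => der_fst hA hB h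

theorem inh_prod_fst (hA : Ty Γ A i) (hB : Ty Γ B i) (hp : Inh Γ (prod A B)) : Inh Γ A :=
  inh_fst hA (.wkTm (.ctxCons hA) hB) hp

theorem inh_prod_snd (hA : Ty Γ A i) (hB : Ty Γ B i) (hp : Inh Γ (prod A B)) : Inh Γ B := by
  have hB' : Ty (A :: Γ) B.wk i := .wkTm (.ctxCons hA) hB
  refine inh_sig_elim hA hB' hB hp ⟨var 0, ?_⟩
  simpa using der_var_zero hB'

/-! Truncation. -/

theorem ty_ex (hA : Ty Γ A i) (hB : Ty (A :: Γ) B i) : Ty Γ (ex A B) i := .trunc (.sig hA hB)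

theorem inh_isProp_trunc (hA : Ty Γ A i) : Inh Γ (isProp (trunc A)) := by
  have h0 : Ty Γ (trunc A) i := .trunc hA
  have h1 := ty_wk h0 h0
  refine inh_pi (inh_pi ⟨squash (A.wkn 2) (var 1) (var 0), ?_⟩)
  have := Der.squash (A := A.wkn 2) (x := var 1) (y := var 0) (i := i)
    (by simpa using ty_wk_two h0 h1 hA) (by simpa using der_var_one h0 h1)
    (by simpa using der_var_zero h1)
  simpa using this

theorem inh_id_of_isProp (h : Inh Γ (isProp A)) (ha : Der (.tm Γ a A)) (hb : Der (.tm Γ b A)) :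
    Inh Γ (id A a b) := by
  have h1 := inh_app_pi h ha
  simp only [subst] at h1
  have h2 := inh_app_pi h1 (by simpa using hb)
  simpa using h2

theorem inh_tr (hA : Ty Γ A i) (h : Inh Γ A) : Inh Γ (trunc A) := h.imp' _ fun _ ht => .tr hA ht

theorem inh_trunc_elim (hA : Ty Γ A i) (hC : Ty Γ C j) (hP : Inh Γ (isProp C))
    (hx : Inh Γ (trunc A)) (hf : Inh (A :: Γ) (C.subst (shift 1))) : Inh Γ C := by
  obtain ⟨h, hh⟩ := hP
  obtain ⟨x, hx⟩ := hx
  obtain ⟨f, hf⟩ := inh_arrow hf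
  exact ⟨_, .recTrunc hA hC hh hf hx⟩

/-- Elimination of an existential into a proposition. -/
theorem inh_ex_elim (hA : Ty Γ A i) (hB : Ty (A :: Γ) B i)
    (hB' : Ty (A.subst (shift 1) :: sig A B :: Γ) (B.subst (cons (var 0) (shift 2))) i)
    (hC : Ty Γ C j) (hP : Inh Γ (isProp C)) (hx : Inh Γ (ex A B))
    (hf : Inh (B :: A :: Γ) (C.subst (shift 2))) : Inh Γ C := by
  have hS : Ty Γ (sig A B) i := .sig hA hB
  refine inh_trunc_elim hS hC hP hx ?_
  obtain ⟨f, hf⟩ := hf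
  -- The rule `wkTm` adds a variable only at the end of the context, whereas `f` must be weakened
  -- below its two variables. Abstracting `f`, weakening the resulting function and applying it
  -- again has the same effect. The hypothesis `hB'` plays this role for the type `B`.
  have hl : Der (.tm Γ (lam A (lam B f)) (pi A (arrow B (C.subst (shift 1))))) :=
    .lam (der_lam (by simpa using hf))
  have hA1 := ty_wk hS hA
  have hv := der_var_one hA1 hB'
  have hv0 := der_var_zero hB'
  have hl3 := der_wk hB' (der_wk hA1 (der_wk hS hl))
  refine inh_sig_elim hA1 hB' (ty_wk hS hC) ?_
    ⟨app (app ((lam A (lam B f)).subst (shift 3)) (var 1)) (var 0),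
      der_app (A := B.subst (cons (var 1) (shift 3))) ?_ ?_⟩
  · exact ⟨var 0, by simpa using der_var_zero hS⟩
  · refine der_app_pi (by simpa using hl3) (by simpa using hv) ?_
    simp
  · simpa using hv0

/-! Identity types. -/

theorem eq_id_left (hA : Ty Γ A i) (e : Der (.eq Γ a b A)) (hc : Der (.tm Γ c A)) :
    Der (.eq Γ (id A a c) (id A b c) (univ i)) := by
  simpa using Der.substCongr e (.id (ty_wk hA hA) (der_var_zero hA) (der_wk hA hc))

theorem eq_id_right (hA : Ty Γ A i) (hc : Der (.tm Γ c A)) (e : Der (.eq Γ a b A)) :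
    Der (.eq Γ (id A c a) (id A c b) (univ i)) := by
  simpa using Der.substCongr e (.id (ty_wk hA hA) (der_wk hA hc) (der_var_zero hA))

theorem eq_id (hA : Ty Γ A i) (ha : Der (.tm Γ a A)) (hd : Der (.tm Γ D A))
    (e : Der (.eq Γ a b A)) (e' : Der (.eq Γ c D A)) :
    Der (.eq Γ (id A a c) (id A b D) (univ i)) :=
  .eqTrans (eq_id_right hA ha e') (eq_id_left hA e hd)

theorem ty_id_var (hA : Ty Γ A i) :
    Ty (A.subst (shift 1) :: A :: Γ) (id (A.subst (shift 2)) (var 1) (var 0)) i :=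
  .id (ty_wk_two hA (ty_wk hA hA) hA) (der_var_one hA (ty_wk hA hA))
    (by simpa using der_var_zero (ty_wk hA hA))

/-- Transport in a family given by a map to a universe. -/
theorem inh_transport_app (hA : Ty Γ A i) (hf : Der (.tm Γ f (arrow A (univ j))))
    (ha : Der (.tm Γ a A)) (hb : Der (.tm Γ b A)) (hp : Inh Γ (id A a b))
    (h : Inh Γ (app f a)) : Inh Γ (app f b) := by
  have hA1 := ty_wk hA hA
  have hI := ty_id_var hA
  have hf1 : Der (.tm (A :: Γ) (f.subst (shift 1)) (arrow (A.subst (shift 1)) (univ j))) := by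
    simpa using der_wk hA hf
  have hf3 : Der (.tm (id (A.subst (shift 2)) (var 1) (var 0) :: A.subst (shift 1) :: A :: Γ)
      (f.subst (shift 3)) (arrow (A.subst (shift 3)) (univ j))) := by
    simpa using der_wk hI (der_wk hA1 hf1)
  have v2 := der_wk hI (der_var_one hA hA1)
  have v1 := der_wk hI (der_var_zero hA1)
  simp at v1 v2
  obtain ⟨p, hp⟩ := hp
  have hc : Ty (A :: Γ) (app (f.subst (shift 1)) (var 0)) j := der_app hf1 (der_var_zero hA)
  -- The motive at `x`, `y` is `f x → f y`, so the reflexivity case is an identity function.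
  have := Der.indId (A := A)
    (C := arrow (app (f.subst (shift 3)) (var 2)) (app (f.subst (shift 3)) (var 1)))
    (c := lam (app (f.subst (shift 1)) (var 0)) (var 0)) (i := j)
    (by simpa using ty_arrow (der_app hf3 v2) (der_app hf3 v1))
    (by
      have := der_lam (der_var_zero hc)
      simpa using this)
    ha hb hp
  simp only [subst_arrow, subst, cons_two, cons_one, cons_zero, subst_subst,
    comp_shift_three_cons, comp_shift_two_cons, comp_shift_one_cons, subst_var] at this
  exact inh_app ⟨_, this⟩ h

/-- Transport. -/
theorem inh_transport (hA : Ty Γ A i) (hC : Ty (A :: Γ) C j)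
    (ha : Der (.tm Γ a A)) (hb : Der (.tm Γ b A)) (hp : Inh Γ (id A a b))
    (h : Inh Γ (C.subst (cons a var))) : Inh Γ (C.subst (cons b var)) := by
  -- Turning the family into a function to the universe avoids weakening `C` below its variable; two
  -- β-conversions restore `C`.
  have hC' : Der (.tm (A :: Γ) C ((univ j).subst (shift 1))) := hC
  exact inh_conv (inh_transport_app hA (der_lam hC') ha hb hp
    (inh_conv h (.eqSymm (eq_beta hC' ha)))) (eq_beta hC' hb)

end structural

/-! Equivalences. -/

/-- The type of right inverses of `f : A → B`. -/
def secTy (A B f : Tm) : Tm :=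
  sig (arrow B A) (pi B.wk (id (B.wkn 2) (app (f.wkn 2) (app (var 1) (var 0))) (var 0)))

/-- The type of left inverses of `f : A → B`. -/
def retTy (A B f : Tm) : Tm :=
  sig (arrow B A) (pi A.wk (id (A.wkn 2) (app (var 1) (app (f.wkn 2) (var 0))) (var 0)))

section equivalences

variable {Γ : Ctx} {A B C D a b c f g p t u : Tm} {i j k : ℕ}

theorem ty_secTy_body (hA : Ty Γ A i) (hB : Ty Γ B i) (hf : Der (.tm Γ f (arrow A B))) :
    Ty (arrow B A :: Γ)
      (pi B.wk (id (B.wkn 2) (app (f.wkn 2) (app (var 1) (var 0))) (var 0))) i := by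
  have h1 := ty_arrow hB hA
  have h2 := ty_wk h1 hB
  have v1 := der_var_one h1 h2
  have v0 := der_var_zero h2
  have hf2 := der_wk_two h1 h2 hf
  simp only [subst_arrow, subst_subst, comp_shift_shift] at v1 v0 hf2
  simpa using Der.pi h2 (.id (ty_wk_two h1 h2 hB) (der_app hf2 (der_app v1 v0)) v0)

theorem ty_retTy_body (hA : Ty Γ A i) (hB : Ty Γ B i) (hf : Der (.tm Γ f (arrow A B))) :
    Ty (arrow B A :: Γ)
      (pi A.wk (id (A.wkn 2) (app (var 1) (app (f.wkn 2) (var 0))) (var 0))) i := by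
  have h1 := ty_arrow hB hA
  have h2 := ty_wk h1 hA
  have v1 := der_var_one h1 h2
  have v0 := der_var_zero h2
  have hf2 := der_wk_two h1 h2 hf
  simp only [subst_arrow, subst_subst, comp_shift_shift] at v1 v0 hf2
  simpa using Der.pi h2 (.id (ty_wk_two h1 h2 hA) (der_app v1 (der_app hf2 v0)) v0)

theorem ty_secTy (hA : Ty Γ A i) (hB : Ty Γ B i) (hf : Der (.tm Γ f (arrow A B))) :
    Ty Γ (secTy A B f) i := .sig (ty_arrow hB hA) (ty_secTy_body hA hB hf)

theorem ty_retTy (hA : Ty Γ A i) (hB : Ty Γ B i) (hf : Der (.tm Γ f (arrow A B))) :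
    Ty Γ (retTy A B f) i := .sig (ty_arrow hB hA) (ty_retTy_body hA hB hf)

theorem ty_isEquiv (hA : Ty Γ A i) (hB : Ty Γ B i) (hf : Der (.tm Γ f (arrow A B))) :
    Ty Γ (isEquiv A B f) i := ty_prod (ty_secTy hA hB hf) (ty_retTy hA hB hf)

theorem ty_eqv_body (hA : Ty Γ A i) (hB : Ty Γ B i) :
    Ty (arrow A B :: Γ) (isEquiv A.wk B.wk (var 0)) i := by
  have h := ty_arrow hA hB
  rw [wk_eq, wk_eq]
  exact ty_isEquiv (ty_wk h hA) (ty_wk h hB) (by simpa using der_var_zero h)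

theorem ty_eqv (hA : Ty Γ A i) (hB : Ty Γ B i) : Ty Γ (eqv A B) i :=
  .sig (ty_arrow hA hB) (ty_eqv_body hA hB)

theorem der_pair_secTy (hA : Ty Γ A i) (hB : Ty Γ B i) (hf : Der (.tm Γ f (arrow A B)))
    (hg : Der (.tm Γ g (arrow B A)))
    (h : Der (.tm (B :: Γ) t (id (B.subst (shift 1))
      (app (f.subst (shift 1)) (app (g.subst (shift 1)) (var 0))) (var 0)))) :
    Der (.tm Γ (pair g (lam B t)) (secTy A B f)) :=
  .pair (ty_secTy_body hA hB hf) hg (by simpa using Der.lam h)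

theorem der_pair_retTy (hA : Ty Γ A i) (hB : Ty Γ B i) (hf : Der (.tm Γ f (arrow A B)))
    (hg : Der (.tm Γ g (arrow B A)))
    (h : Der (.tm (A :: Γ) t (id (A.subst (shift 1))
      (app (g.subst (shift 1)) (app (f.subst (shift 1)) (var 0))) (var 0)))) :
    Der (.tm Γ (pair g (lam A t)) (retTy A B f)) :=
  .pair (ty_retTy_body hA hB hf) hg (by simpa using Der.lam h)

theorem der_pair_eqv (hA : Ty Γ A i) (hB : Ty Γ B i) (hf : Der (.tm Γ f (arrow A B)))
    (h : Der (.tm Γ t (isEquiv A B f))) : Der (.tm Γ (pair f t) (eqv A B)) :=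
  .pair (ty_eqv_body hA hB) hf (by simpa using h)

theorem der_idEqv (hA : Ty Γ A i) : Der (.tm Γ (idEqv A) (eqv A A)) := by
  have hid : Der (.tm Γ (lam A (var 0)) (arrow A A)) := der_lam (der_var_zero hA)
  have hA1 := ty_wk hA hA
  have v := der_var_zero hA
  have hid1 := der_wk hA hid
  rw [subst_arrow] at hid1
  have e : Der (.eq (A :: Γ) (app ((lam A (var 0)).subst (shift 1)) (var 0)) (var 0)
      (A.subst (shift 1))) := by
    simpa using eq_beta (der_var_zero hA1) v
  have e2 := Der.eqTrans (eq_app_arg hA1 hid1 e) e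
  have hr : Der (.tm (A :: Γ) (refl (var 0)) (id (A.subst (shift 1))
      (app ((lam A (var 0)).subst (shift 1)) (app ((lam A (var 0)).subst (shift 1)) (var 0)))
      (var 0))) :=
    .convTm (.refl hA1 v) (.eqSymm (eq_id_left hA1 e2 v))
  exact der_pair_eqv hA hA hid (der_pair_prod (ty_secTy hA hA hid) (ty_retTy hA hA hid)
    (der_pair_secTy hA hA hid hid hr) (der_pair_retTy hA hA hid hid hr))

theorem inh_isEquiv_inv (hA : Ty Γ A i) (hB : Ty Γ B i) (hf : Der (.tm Γ f (arrow A B)))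
    (h : Inh Γ (isEquiv A B f)) : Inh Γ (arrow B A) :=
  inh_fst (ty_arrow hB hA) (ty_secTy_body hA hB hf)
    (inh_prod_fst (ty_secTy hA hB hf) (ty_retTy hA hB hf) h)

/-- The path is taken from `f b` to `f a` so that transport alone suffices: from `g (f b) = b` one
reaches `g (f a) = b`, then `a = b` along `g (f a) = a`, with no inversion or concatenation of
paths. -/
theorem inh_id_of_retraction (hA : Ty Γ A i) (hB : Ty Γ B i) (hf : Der (.tm Γ f (arrow A B)))
    (hg : Der (.tm Γ g (arrow B A)))
    (h : Inh Γ (pi A (id (A.subst (shift 1))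
      (app (g.subst (shift 1)) (app (f.subst (shift 1)) (var 0))) (var 0))))
    (ha : Der (.tm Γ a A)) (hb : Der (.tm Γ b A)) (hp : Inh Γ (id B (app f b) (app f a))) :
    Inh Γ (id A a b) := by
  have ea := inh_app_pi h ha
  have eb := inh_app_pi h hb
  simp only [subst, subst_subst, comp_shift_one_cons, subst_var, cons_zero] at ea eb
  have hg1 := der_wk hB hg
  rw [subst_arrow] at hg1
  have h1 := inh_transport (C := id (A.subst (shift 1)) (app (g.subst (shift 1)) (var 0))
    (b.subst (shift 1))) hB (.id (ty_wk hB hA) (der_app hg1 (der_var_zero hB)) (der_wk hB hb))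
    (der_app hf hb) (der_app hf ha) hp (by simpa using eb)
  have h2 := inh_transport (C := id (A.subst (shift 1)) (var 0)
    (b.subst (shift 1))) hA (.id (ty_wk hA hA) (der_var_zero hA) (der_wk hA hb))
    (der_app hg (der_app hf ha)) ha ea (by simpa using h1)
  simpa using h2

/-- Equivalences are injective. -/
theorem inh_id_of_isEquiv (hA : Ty Γ A i) (hB : Ty Γ B i) (hf : Der (.tm Γ f (arrow A B)))
    (h : Inh Γ (isEquiv A B f)) (ha : Der (.tm Γ a A)) (hb : Der (.tm Γ b A))
    (hp : Inh Γ (id B (app f b) (app f a))) : Inh Γ (id A a b) := by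
  have h1 := ty_arrow hB hA
  have h2 := ty_retTy_body hA hB hf
  refine inh_sig_elim h1 h2 (.id hA ha hb)
    (inh_prod_snd (ty_secTy hA hB hf) (ty_retTy hA hB hf) h) ?_
  refine inh_id_of_retraction (f := f.subst (shift 2)) (g := var 1)
    (ty_wk_two h1 h2 hA) (ty_wk_two h1 h2 hB) (by simpa using der_wk_two h1 h2 hf)
    (by simpa using der_var_one h1 h2) ⟨var 0, by simpa using der_var_zero h2⟩
    (der_wk_two h1 h2 ha) (der_wk_two h1 h2 hb) (by simpa using inh_wk_two h1 h2 hp)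

/-- A map between propositions is an equivalence if there is a map back. -/
theorem inh_isEquiv_of_isProp (hA : Ty Γ A i) (hB : Ty Γ B i) (hPA : Inh Γ (isProp A))
    (hPB : Inh Γ (isProp B)) (hf : Der (.tm Γ f (arrow A B))) (hg : Inh Γ (arrow B A)) :
    Inh Γ (isEquiv A B f) := by
  obtain ⟨g, hg⟩ := hg
  have hfA := der_wk hA hf
  have hgA := der_wk hA hg
  have hfB := der_wk hB hf
  have hgB := der_wk hB hg
  have hPA1 := inh_wk hA hPA
  have hPB1 := inh_wk hB hPB
  rw [subst_arrow] at hfA hgA hfB hgB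
  rw [subst_isProp] at hPA1 hPB1
  have vA := der_var_zero hA
  have vB := der_var_zero hB
  obtain ⟨s, hs⟩ := inh_id_of_isProp hPB1 (der_app hfB (der_app hgB vB)) vB
  obtain ⟨r, hr⟩ := inh_id_of_isProp hPA1 (der_app hgA (der_app hfA vA)) vA
  exact ⟨_, der_pair_prod (ty_secTy hA hB hf) (ty_retTy hA hB hf)
    (der_pair_secTy hA hB hf hg hs) (der_pair_retTy hA hB hf hg hr)⟩

/-! Univalence. -/

theorem der_idToEqv (hA : Ty Γ A i) (hB : Ty Γ B i) :
    Der (.tm Γ (idToEqv i A B) (arrow (id (univ i) A B) (eqv A B))) := by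
  have hU : Ty Γ (univ i) (i + 1) := .univ (ctx_of_der hA)
  have hI : Ty Γ (id (univ i) A B) (i + 1) := .id hU hA hB
  have hU' : Ty (id (univ i) A B :: Γ) (univ i) (i + 1) := ty_univ hI
  have hU1 := ty_wk hU' hU'
  have hI3 := ty_id_var hU'
  have v2 := der_wk hI3 (der_var_one hU' hU1)
  have v1 := der_wk hI3 (der_var_zero hU1)
  simp only [subst] at v1 v2 hI3
  have := Der.indId (C := eqv (var 2) (var 1)) (c := idEqv (var 0)) (p := var 0) (i := i)
    (by simpa using ty_eqv v2 v1) (by simpa using der_idEqv (der_var_zero hU'))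
    (der_wk hI hA) (der_wk hI hB) (by simpa using der_var_zero hI)
  refine der_lam ?_
  simpa using this

theorem inh_arrow_of_id (hA : Ty Γ A i) (hB : Ty Γ B i) (h : Inh Γ (id (univ i) A B)) :
    Inh Γ (arrow A B) :=
  inh_fst (ty_arrow hA hB) (ty_eqv_body hA hB) (inh_app ⟨_, der_idToEqv hA hB⟩ h)

/-- Propositional univalence. -/
theorem inh_id_univ_of_isProp (hA : Ty Γ A i) (hB : Ty Γ B i) (hPA : Inh Γ (isProp A))
    (hPB : Inh Γ (isProp B)) (hf : Inh Γ (arrow A B)) (hg : Inh Γ (arrow B A)) :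
    Inh Γ (id (univ i) A B) := by
  obtain ⟨f, hf⟩ := hf
  obtain ⟨e, he⟩ := inh_isEquiv_of_isProp hA hB hPA hPB hf hg
  have hU : Ty Γ (univ i) (i + 1) := .univ (ctx_of_der hA)
  -- Identities in `univ i` live at level `i + 1`, so the type of equivalences is raised to that
  -- level before the univalence equivalence is inverted.
  exact inh_app (inh_isEquiv_inv (.id hU hA hB) (.cumul (ty_eqv hA hB)) (der_idToEqv hA hB)
    ⟨_, .ua hA hB⟩) ⟨_, der_pair_eqv hA hB hf he⟩

/-! Function extensionality for non-dependent functions. -/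

theorem ty_homotopy_body (hA : Ty Γ A i) (hB : Ty Γ B i) (hf : Der (.tm Γ f (arrow A B)))
    (hg : Der (.tm Γ g (arrow A B))) :
    Ty (A :: Γ) (id (B.subst (shift 1)) (app (f.subst (shift 1)) (var 0))
      (app (g.subst (shift 1)) (var 0))) i := by
  have hf1 := der_wk hA hf
  have hg1 := der_wk hA hg
  rw [subst_arrow] at hf1 hg1
  exact .id (ty_wk hA hB) (der_app hf1 (der_var_zero hA)) (der_app hg1 (der_var_zero hA))

theorem ty_homotopy (hA : Ty Γ A i) (hB : Ty Γ B i) (hf : Der (.tm Γ f (arrow A B)))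
    (hg : Der (.tm Γ g (arrow A B))) : Ty Γ (homotopy A (B.subst (shift 1)) f g) i := by
  rw [homotopy, wk_eq, wk_eq]
  exact .pi hA (ty_homotopy_body hA hB hf hg)

theorem der_happly (hA : Ty Γ A i) (hB : Ty Γ B i) (hf : Der (.tm Γ f (arrow A B)))
    (hg : Der (.tm Γ g (arrow A B))) :
    Der (.tm Γ (happly A (B.subst (shift 1)) f g)
      (arrow (id (arrow A B) f g) (homotopy A (B.subst (shift 1)) f g))) := by
  have hP := ty_arrow hA hB
  have hI : Ty Γ (id (arrow A B) f g) i := .id hP hf hg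
  have hP1 : Ty (id (arrow A B) f g :: Γ) (arrow (A.subst (shift 1)) (B.subst (shift 1))) i :=
    by simpa using ty_wk hI hP
  have hP2 := ty_wk hP1 hP1
  have hI3 := ty_id_var hP1
  have v2 := der_wk hI3 (der_var_one hP1 hP2)
  have v1 := der_wk hI3 (der_var_zero hP2)
  have hA4 := ty_wk hI3 (ty_wk hP2 (ty_wk hP1 (ty_wk hI hA)))
  have hB4 := ty_wk hI3 (ty_wk hP2 (ty_wk hP1 (ty_wk hI hB)))
  have hA2 := ty_wk hP1 (ty_wk hI hA)
  have hB2 := ty_wk hP1 (ty_wk hI hB)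
  simp at v1 v2 hA4 hB4 hA2 hB2
  have hc : Der (.tm (A.subst (shift 2) :: arrow (A.subst (shift 1)) (B.subst (shift 1)) ::
        id (arrow A B) f g :: Γ)
      (refl (app (var 1) (var 0)))
      (id (B.subst (shift 3)) (app (var 1) (var 0)) (app (var 1) (var 0)))) := by
    have w := der_wk hA2 (der_var_zero hP1)
    simp at w
    have w0 := der_var_zero hA2
    have hB3 := ty_wk hA2 hB2
    simp at w0 hB3
    simpa using Der.refl hB3 (der_app w w0)
  -- The weakening by four passes the variable of the outer `lam` and the three variables of the
  -- motive.
  have := Der.indId (A := arrow (A.subst (shift 1)) (B.subst (shift 1)))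
    (C := homotopy (A.wkn 4) ((B.subst (shift 1)).wknUnder 4) (var 2) (var 1))
    (c := lam (A.wkn 2) (refl (app (var 1) (var 0)))) (p := var 0) (i := i)
    (by simpa using ty_homotopy hA4 hB4 v2 v1) (by simpa [homotopy] using Der.lam hc)
    (by simpa using der_wk hI hf) (by simpa using der_wk hI hg)
    (by simpa using der_var_zero hI)
  rw [happly, show pi A (B.subst (shift 1)) = arrow A B by simp [arrow]]
  refine der_lam ?_
  simpa using this

/-- Pointwise equal functions are equal. -/
theorem inh_funext (hA : Ty Γ A i) (hB : Ty Γ B i) (hf : Der (.tm Γ f (arrow A B)))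
    (hg : Der (.tm Γ g (arrow A B)))
    (h : Inh (A :: Γ) (id (B.subst (shift 1)) (app (f.subst (shift 1)) (var 0))
      (app (g.subst (shift 1)) (var 0)))) :
    Inh Γ (id (arrow A B) f g) := by
  have hF := Der.funext (B := B.subst (shift 1)) hA (ty_wk hA hB)
    (by simpa [arrow] using hf) (by simpa [arrow] using hg)
  refine inh_app (inh_isEquiv_inv (.id (ty_arrow hA hB) hf hg) (ty_homotopy hA hB hf hg)
    (der_happly hA hB hf hg) ⟨_, by simpa [arrow] using hF⟩) ?_
  simpa [homotopy] using inh_pi h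

/-- Functions into a proposition form a proposition. -/
theorem inh_isProp_arrow (hA : Ty Γ A i) (hB : Ty Γ B i) (hP : Inh Γ (isProp B)) :
    Inh Γ (isProp (arrow A B)) := by
  have h0 := ty_arrow hA hB
  have h1 : Ty (arrow A B :: Γ) (arrow (A.subst (shift 1)) (B.subst (shift 1))) i := by
    simpa using ty_wk h0 h0
  have v1 := der_var_one h0 h1
  have v0 := der_var_zero h1
  have hA2 := ty_wk_two h0 h1 hA
  have hB2 := ty_wk_two h0 h1 hB
  have hP3 := inh_wk hA2 (inh_wk_two h0 h1 hP)
  have w1 := der_wk hA2 v1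
  have w0 := der_wk hA2 v0
  simp only [subst_arrow, subst_isProp, subst_subst, subst, shift_one_apply, shift_zero_apply,
    comp_shift_shift, Nat.reduceAdd] at v1 v0 w1 w0 hP3
  have w := der_var_zero hA2
  simp only [subst_subst, comp_shift_shift, Nat.reduceAdd] at w
  have := inh_funext hA2 hB2 v1 v0
    (by simpa using inh_id_of_isProp hP3 (der_app w1 w) (der_app w0 w))
  exact inh_pi (inh_pi (by simpa using this))

end equivalences

/-! Sheafification. -/

/-- `I` is a type of level `l` and `T` a family over it of types of level `n ≤ l`. -/
structure IsCollection (Γ : Ctx) (I T : Tm) (n l : ℕ) : Prop where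
  ty : Ty Γ I l
  der : Der (.tm Γ T (arrow I (univ n)))
  le : n ≤ l

/-- The unit of sheafification. -/
def sheafUnit (I T A a : Tm) : Tm := nullUnit I (trunc (app T.wk (var 0))) A a

/-- `Y` is a sheaf. -/
def isSheaf (I T Y : Tm) : Tm := isNull I (trunc (app T.wk (var 0))) Y

/-- Precomposition with the unit of sheafification. -/
def sheafPrecomp (I T A Y : Tm) : Tm := precompUnit I (trunc (app T.wk (var 0))) A Y

@[simp] theorem subst_sheafUnit (I T A a : Tm) (s : ℕ → Tm) :
    (sheafUnit I T A a).subst s =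
      sheafUnit (I.subst s) (T.subst s) (A.subst s) (a.subst s) := by
  simp [sheafUnit]

@[simp] theorem subst_sheafPrecomp (I T A Y : Tm) (s : ℕ → Tm) :
    (sheafPrecomp I T A Y).subst s =
      sheafPrecomp (I.subst s) (T.subst s) (A.subst s) (Y.subst s) := by
  simp [sheafPrecomp]

section sheaves

variable {Γ : Ctx} {I T A B C D X Y a b c f g p t u v x y : Tm} {i j k l n : ℕ}

theorem IsCollection.wk (h : IsCollection Γ I T n l) (hA : Ty Γ A i) :
    IsCollection (A :: Γ) (I.subst (shift 1)) (T.subst (shift 1)) n l :=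
  ⟨ty_wk hA h.ty, by simpa using der_wk hA h.der, h.le⟩

theorem IsCollection.wk_two (h : IsCollection Γ I T n l) (hA : Ty Γ A i)
    (hB : Ty (A :: Γ) B j) :
    IsCollection (B :: A :: Γ) (I.subst (shift 2)) (T.subst (shift 2)) n l :=
  ⟨ty_wk_two hA hB h.ty, by simpa using der_wk_two hA hB h.der, h.le⟩

theorem IsCollection.ty_app (h : IsCollection Γ I T n l) (ha : Der (.tm Γ a I)) :
    Ty Γ (app T a) n := der_app h.der ha

theorem IsCollection.ty_app_var (h : IsCollection Γ I T n l) :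
    Ty (I :: Γ) (app (T.subst (shift 1)) (var 0)) n := (h.wk h.ty).ty_app (der_var_zero h.ty)

/-- The rules of nullification put the index type and the family at one common level; `n ≤ l` raises
the family to the level of `I`. -/
theorem IsCollection.ty_trunc (h : IsCollection Γ I T n l) :
    Ty (I :: Γ) (trunc (app T.wk (var 0))) l :=
  .trunc (ty_of_le h.le (by simpa using h.ty_app_var))

theorem ty_sheafify (h : IsCollection Γ I T n l) (hA : Ty Γ A l) : Ty Γ (sheafify I T A) l :=
  .null h.ty h.ty_trunc hA

theorem der_sheafUnit (h : IsCollection Γ I T n l) (hA : Ty Γ A l) (ha : Der (.tm Γ a A)) :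
    Der (.tm Γ (sheafUnit I T A a) (sheafify I T A)) := .nullUnit h.ty h.ty_trunc hA ha

theorem inh_isSheaf_sheafify (h : IsCollection Γ I T n l) (hA : Ty Γ A l) :
    Inh Γ (isSheaf I T (sheafify I T A)) := ⟨_, .nullIsNull h.ty h.ty_trunc hA⟩

theorem der_sheafPrecomp_body (h : IsCollection Γ I T n l) (hA : Ty Γ A l) (hY : Ty Γ Y l) :
    Der (.tm (arrow (sheafify I T A) Y :: Γ)
      (lam A.wk (app (var 1) (sheafUnit (I.wkn 2) (T.wkn 2) (A.wkn 2) (var 0))))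
      (arrow (A.subst (shift 1)) (Y.subst (shift 1)))) := by
  have h0 := ty_arrow (ty_sheafify h hA) hY
  have h1 := ty_wk h0 hA
  have v0 := der_var_zero h1
  have v1 := der_var_one h0 h1
  simp only [subst_subst, comp_shift_shift, Nat.reduceAdd, subst_arrow, subst_sheafify] at v0 v1
  have := der_app v1 (der_sheafUnit (h.wk_two h0 h1) (ty_wk_two h0 h1 hA) v0)
  simpa using der_lam (by simpa using this)

theorem sheafPrecomp_eq (I T A Y : Tm) : sheafPrecomp I T A Y =
    lam (arrow (sheafify I T A) Y)
      (lam A.wk (app (var 1) (sheafUnit (I.wkn 2) (T.wkn 2) (A.wkn 2) (var 0)))) := by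
  simp [sheafPrecomp, precompUnit, sheafUnit, sheafify]

theorem der_sheafPrecomp (h : IsCollection Γ I T n l) (hA : Ty Γ A l) (hY : Ty Γ Y l) :
    Der (.tm Γ (sheafPrecomp I T A Y) (arrow (arrow (sheafify I T A) Y) (arrow A Y))) := by
  rw [sheafPrecomp_eq]
  exact der_lam (by simpa using der_sheafPrecomp_body h hA hY)

theorem inh_isEquiv_sheafPrecomp (h : IsCollection Γ I T n l) (hA : Ty Γ A l) (hY : Ty Γ Y l)
    (hs : Inh Γ (isSheaf I T Y)) :
    Inh Γ (isEquiv (arrow (sheafify I T A) Y) (arrow A Y) (sheafPrecomp I T A Y)) :=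
  hs.imp' _ fun _ hs => .nullRec h.ty h.ty_trunc hA hY hs

/-- Maps into a sheaf extend along the unit. -/
theorem inh_sheafify_rec (h : IsCollection Γ I T n l) (hA : Ty Γ A l) (hY : Ty Γ Y l)
    (hs : Inh Γ (isSheaf I T Y)) (hf : Inh Γ (arrow A Y)) : Inh Γ (arrow (sheafify I T A) Y) :=
  inh_app (inh_isEquiv_inv (ty_arrow (ty_sheafify h hA) hY) (ty_arrow hA hY)
    (der_sheafPrecomp h hA hY) (inh_isEquiv_sheafPrecomp h hA hY hs)) hf

theorem eq_app_fun (hA : Ty Γ A i) (hB : Ty Γ B i) (e : Der (.eq Γ f g (arrow A B)))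
    (ha : Der (.tm Γ a A)) : Der (.eq Γ (app f a) (app g a) B) := by
  have h0 := ty_arrow hA hB
  have hv := der_var_zero h0
  rw [subst_arrow] at hv
  simpa using Der.substCongr e (der_app hv (der_wk h0 ha))

/-- Two β-steps, one for each abstraction in `precompUnit`. -/
theorem eq_sheafPrecomp (h : IsCollection Γ I T n l) (hA : Ty Γ A l) (hY : Ty Γ Y l)
    (hu : Der (.tm Γ u (arrow (sheafify I T A) Y))) (ha : Der (.tm Γ a A)) :
    Der (.eq Γ (app (app (sheafPrecomp I T A Y) u) a) (app u (sheafUnit I T A a)) Y) := by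
  have hN := ty_sheafify h hA
  have h1 := eq_beta (B := arrow A Y)
    (b := lam A.wk (app (var 1) (sheafUnit (I.wkn 2) (T.wkn 2) (A.wkn 2) (var 0))))
    (by simpa using der_sheafPrecomp_body h hA hY) hu
  simp only [← sheafPrecomp_eq] at h1
  refine .eqTrans (eq_app_fun hA hY h1 ha) ?_
  have hu1 := der_wk hA hu
  simp only [subst_arrow, subst_sheafify] at hu1
  have := eq_beta (der_app hu1 (der_sheafUnit (h.wk hA) (ty_wk hA hA) (der_var_zero hA))) ha
  simpa using this

/-- Maps from a sheafification to a sheaf are equal if they agree on the unit. -/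
theorem inh_sheafify_ext (h : IsCollection Γ I T n l) (hA : Ty Γ A l) (hY : Ty Γ Y l)
    (hs : Inh Γ (isSheaf I T Y)) (hu : Der (.tm Γ u (arrow (sheafify I T A) Y)))
    (hv : Der (.tm Γ v (arrow (sheafify I T A) Y))) (hx : Der (.tm Γ x (sheafify I T A)))
    (e : Inh (A :: Γ) (id (Y.subst (shift 1))
      (app (v.subst (shift 1))
        (sheafUnit (I.subst (shift 1)) (T.subst (shift 1)) (A.subst (shift 1)) (var 0)))
      (app (u.subst (shift 1))
        (sheafUnit (I.subst (shift 1)) (T.subst (shift 1)) (A.subst (shift 1)) (var 0))))) :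
    Inh Γ (id Y (app u x) (app v x)) := by
  have hN := ty_sheafify h hA
  have h0 := ty_arrow hN hY
  have hp := der_sheafPrecomp h hA hY
  have hA1 := ty_wk hA hA
  have hY1 := ty_wk hA hY
  have hu1 := der_wk hA hu
  have hv1 := der_wk hA hv
  simp only [subst_arrow, subst_sheafify] at hu1 hv1
  have w := der_var_zero hA
  have hη := der_sheafUnit (h.wk hA) hA1 w
  have h1 : Inh Γ (id (arrow (sheafify I T A) Y) u v) := by
    -- Precomposition with the unit is an equivalence, hence injective. Injectivity takes its path
    -- in reverse order, which is why the hypothesis `e` runs from `v` to `u`.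
    refine inh_id_of_isEquiv h0 (ty_arrow hA hY) hp (inh_isEquiv_sheafPrecomp h hA hY hs) hu hv
      (inh_funext hA hY (der_app hp hv) (der_app hp hu) ?_)
    simp only [subst, subst_sheafPrecomp]
    refine inh_conv e (.eqSymm (eq_id hY1 ?_ (der_app hu1 hη)
      (eq_sheafPrecomp (h.wk hA) hA1 hY1 hv1 w)
      (eq_sheafPrecomp (h.wk hA) hA1 hY1 hu1 w)))
    exact der_app (der_app (der_sheafPrecomp (h.wk hA) hA1 hY1) hv1) w
  have hu2 := der_wk h0 hu
  have hx2 := der_wk h0 hx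
  have v2 := der_var_zero h0
  simp only [subst_arrow, subst_sheafify] at hu2 hx2 v2
  -- Evaluation at `x`: reflexivity is transported along `u = v` in the family `u x = w x`, with `w`
  -- varying.
  have := inh_transport (C := id (Y.subst (shift 1)) (app (u.subst (shift 1)) (x.subst (shift 1)))
    (app (var 0) (x.subst (shift 1)))) h0 (.id (ty_wk h0 hY) (der_app hu2 hx2) (der_app v2 hx2))
    hu hv h1 ⟨_, by simpa using Der.refl hY (der_app hu hx)⟩
  simpa using this

theorem inh_id_sheafUnit (h : IsCollection Γ I T n l) (hA : Ty Γ A l) (ha : Der (.tm Γ a A))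
    (hb : Der (.tm Γ b A)) (e : Inh Γ (id A a b)) :
    Inh Γ (id (sheafify I T A) (sheafUnit I T A a) (sheafUnit I T A b)) := by
  have hN := ty_sheafify h hA
  have hη := der_sheafUnit h hA ha
  have := inh_transport (C := id ((sheafify I T A).subst (shift 1))
    ((sheafUnit I T A a).subst (shift 1))
    (sheafUnit (I.subst (shift 1)) (T.subst (shift 1)) (A.subst (shift 1)) (var 0))) hA
    (.id (ty_wk hA hN) (der_wk hA hη)
      (by simpa using der_sheafUnit (h.wk hA) (ty_wk hA hA) (der_var_zero hA)))
    ha hb e ⟨_, by simpa using Der.refl hN hη⟩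
  simpa using this

/-- The identity of the sheafification and the constant map at the unit of `b` agree on units
because `A` is a proposition, hence they agree everywhere. -/
theorem inh_id_sheafUnit_right (h : IsCollection Γ I T n l) (hA : Ty Γ A l)
    (hP : Inh Γ (isProp A)) (hx : Der (.tm Γ x (sheafify I T A))) (hb : Der (.tm Γ b A)) :
    Inh Γ (id (sheafify I T A) x (sheafUnit I T A b)) := by
  have hN := ty_sheafify h hA
  have hη := der_sheafUnit h hA hb
  have hu := der_lam (der_var_zero hN)
  have hv := der_lam (der_wk hN hη)
  have hA1 := ty_wk hA hA
  have hN1 := ty_wk hA hN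
  have h1 := h.wk hA
  have hb1 := der_wk hA hb
  have w := der_var_zero hA
  have hη0 := der_sheafUnit h1 hA1 w
  have hη1 := der_sheafUnit h1 hA1 hb1
  have hN2 := ty_sheafify h1 hA1
  have hu1 := der_wk hA hu
  have hv1 := der_wk hA hv
  have hP1 := inh_wk hA hP
  rw [subst_arrow, subst_sheafify] at hu1 hv1
  rw [subst_isProp] at hP1
  have eu := eq_beta (der_var_zero hN2) hη0
  have ev := eq_beta (der_wk hN2 hη1) hη0
  have := inh_sheafify_ext h hA hN (inh_isSheaf_sheafify h hA) hu hv hx (by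
    rw [subst_sheafify]
    refine inh_conv (inh_id_sheafUnit h1 hA1 hb1 w (inh_id_of_isProp hP1 hb1 w))
      (.eqSymm (eq_id hN2 (der_app hv1 hη0) hη0 ?_ ?_))
    · simpa using ev
    · simpa using eu)
  refine inh_conv this (eq_id hN (der_app hu hx) hη ?_ ?_)
  · simpa using eq_beta (der_var_zero hN) hx
  · simpa using eq_beta (der_wk hN hη) hx

/-- Second use of uniqueness: by the preceding lemma `x` equals every unit, so the constant map at
`x` agrees on units with the identity, and both are evaluated at `y`. -/
theorem inh_id_sheafify (h : IsCollection Γ I T n l) (hA : Ty Γ A l)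
    (hP : Inh Γ (isProp A)) (hx : Der (.tm Γ x (sheafify I T A)))
    (hy : Der (.tm Γ y (sheafify I T A))) :
    Inh Γ (id (sheafify I T A) y x) := by
  have hN := ty_sheafify h hA
  have hu := der_lam (der_var_zero hN)
  have hv := der_lam (der_wk hN hx)
  have hA1 := ty_wk hA hA
  have h1 := h.wk hA
  have hx1 := der_wk hA hx
  have w := der_var_zero hA
  have hη0 := der_sheafUnit h1 hA1 w
  have hN2 := ty_sheafify h1 hA1
  have hu1 := der_wk hA hu
  have hv1 := der_wk hA hv
  have hP1 := inh_wk hA hP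
  rw [subst_arrow] at hu1 hv1
  rw [subst_sheafify] at hu1 hv1 hx1
  rw [subst_isProp] at hP1
  have eu := eq_beta (der_var_zero hN2) hη0
  have ev := eq_beta (der_wk hN2 hx1) hη0
  have := inh_sheafify_ext h hA hN (inh_isSheaf_sheafify h hA) hu hv hy (by
    rw [subst_sheafify]
    refine inh_conv (inh_id_sheafUnit_right h1 hA1 hP1 hx1 w)
      (.eqSymm (eq_id hN2 (der_app hv1 hη0) hη0 ?_ ?_))
    · simpa using ev
    · simpa using eu)
  refine inh_conv this (eq_id hN (der_app hu hy) hx ?_ ?_)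
  · simpa using eq_beta (der_var_zero hN) hy
  · simpa using eq_beta (der_wk hN hx) hy

/-- The sheafification of a proposition is a proposition. -/
theorem inh_isProp_sheafify (h : IsCollection Γ I T n l) (hA : Ty Γ A l)
    (hP : Inh Γ (isProp A)) : Inh Γ (isProp (sheafify I T A)) := by
  have hN := ty_sheafify h hA
  have hN1 := ty_wk hN hN
  have v0 := der_var_zero hN1
  have v1 := der_var_one hN hN1
  have hP2 := inh_wk_two hN hN1 hP
  simp only [subst_isProp] at hP2
  have := inh_id_sheafify (h.wk_two hN hN1) (ty_wk_two hN hN1 hA) hP2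
    (x := var 0) (y := var 1) (by simpa using v0) (by simpa using v1)
  exact inh_pi (inh_pi (by simpa using this))

/-! ### The sheaf condition for propositions, and descent -/

theorem der_diagonal (hY : Ty Γ Y i) (hB : Ty Γ B j) :
    Der (.tm Γ (lam Y (lam B.wk (var 1))) (arrow Y (arrow B Y))) := by
  have hB1 : Ty (Y :: Γ) B.wk j := by simpa using ty_wk hY hB
  have := der_var_one hY hB1
  exact der_lam (by simpa using der_lam (A := B.wk) (B := Y.wk) (by simpa using this))

/-- A proposition `Y` is a sheaf if it holds whenever it holds on some member of the cover. -/
theorem inh_isSheaf_of_isProp (h : IsCollection Γ I T n l) (hY : Ty Γ Y l)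
    (hP : Inh Γ (isProp Y))
    (hf : Inh (arrow (trunc (app (T.subst (shift 1)) (var 0))) (Y.subst (shift 1)) :: I :: Γ)
      (Y.subst (shift 2))) : Inh Γ (isSheaf I T Y) := by
  have hY1 := ty_wk h.ty hY
  have hB := h.ty_trunc
  have hP1 := inh_wk h.ty hP
  rw [subst_isProp] at hP1
  rw [wk_eq] at hB
  have := inh_isEquiv_of_isProp hY1 (ty_arrow hB hY1) hP1 (inh_isProp_arrow hB hY1 hP1)
    (der_diagonal hY1 hB) (inh_arrow (by simpa using hf))
  exact inh_pi (by simpa using this)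

/-- The inverse of the diagonal glues an element given on the cover. -/
theorem inh_of_isSheaf (h : IsCollection Γ I T n l) (hY : Ty Γ Y l)
    (hs : Inh Γ (isSheaf I T Y)) (ha : Der (.tm Γ a I))
    (hf : Inh Γ (arrow (trunc (app T a)) Y)) : Inh Γ Y := by
  have hB : Ty Γ (trunc (app T a)) l := .trunc (ty_of_le h.le (h.ty_app ha))
  have h1 := inh_app_pi hs ha
  exact inh_app (inh_isEquiv_inv hY (ty_arrow hB hY) (der_diagonal hY hB)
    (by simpa using h1)) hf

end sheaves

/-! Covers by members of a projective presentation. -/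

/-- `∃ i : I, T i → S`. -/
def localEx (I T S : Tm) : Tm := ex I (arrow (app T.wk (var 0)) S.wk)

@[simp] theorem subst_localEx (I T S : Tm) (s : ℕ → Tm) :
    (localEx I T S).subst s = localEx (I.subst s) (T.subst s) (S.subst s) := by
  simp [localEx]

/-- Members of `T` are closed under dependent sums. -/
def sigClosed (n : ℕ) (I T : Tm) : Tm :=
  pi (univ n) (pi (arrow (var 0) (univ n))
    (arrow (mem n (I.wkn 2) (T.wkn 2) (var 1))
      (arrow (pi (var 1) (mem n (I.wkn 3) (T.wkn 3) (app (var 1) (var 0))))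
        (mem n (I.wkn 2) (T.wkn 2) (sig (var 1) (app (var 1) (var 0)))))))

/-- Members of `T` are projective for families in `univ l`. -/
def membersProjective (n l : ℕ) (I T : Tm) : Tm :=
  pi (univ n) (arrow (mem n I.wk T.wk (var 0)) (isProjective l (var 0)))

@[simp] theorem subst_sigClosed (n : ℕ) (I T : Tm) (s : ℕ → Tm) :
    (sigClosed n I T).subst s = sigClosed n (I.subst s) (T.subst s) := by simp [sigClosed]

@[simp] theorem subst_membersProjective (n l : ℕ) (I T : Tm) (s : ℕ → Tm) :
    (membersProjective n l I T).subst s = membersProjective n l (I.subst s) (T.subst s) := by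
  simp [membersProjective]

/-- `T` is a projective presentation, with the components of the proof separated. -/
structure IsProjPres (Γ : Ctx) (I T : Tm) (n l : ℕ) : Prop where
  coll : IsCollection Γ I T n l
  unit : Inh Γ (mem n I T unit)
  sig : Inh Γ (sigClosed n I T)
  proj : Inh Γ (membersProjective n l I T)

section presentations

variable {Γ : Ctx} {I T A B C D F S X Y a b c f g p q t u v x y : Tm} {i j k l n : ℕ}

theorem IsProjPres.wk (h : IsProjPres Γ I T n l) (hA : Ty Γ A i) :
    IsProjPres (A :: Γ) (I.subst (shift 1)) (T.subst (shift 1)) n l :=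
  ⟨h.coll.wk hA, by simpa using inh_wk hA h.unit, by simpa using inh_wk hA h.sig,
    by simpa using inh_wk hA h.proj⟩

theorem IsProjPres.wk_two (h : IsProjPres Γ I T n l) (hA : Ty Γ A i) (hB : Ty (A :: Γ) B j) :
    IsProjPres (B :: A :: Γ) (I.subst (shift 2)) (T.subst (shift 2)) n l := by
  simpa using (h.wk hA).wk hB

theorem inh_comp (hA : Ty Γ A i) (hf : Inh Γ (arrow A B)) (hg : Inh Γ (arrow B C)) :
    Inh Γ (arrow A C) := by
  have hf1 := inh_wk hA hf
  have hg1 := inh_wk hA hg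
  rw [subst_arrow] at hf1 hg1
  exact inh_arrow (inh_app hg1 (inh_app hf1 ⟨_, der_var_zero hA⟩))

theorem eq_arrow_left (hA : Ty Γ A i) (e : Der (.eq Γ A B (univ i))) (hC : Ty Γ C i) :
    Der (.eq Γ (arrow A C) (arrow B C) (univ i)) :=
  .piCongr e (.eqRefl (.wkTm (.ctxCons hA) hC))

theorem eq_trunc (hA : Ty Γ A i) (e : Der (.eq Γ A B (univ i))) :
    Der (.eq Γ (trunc A) (trunc B) (univ i)) := by
  have hU : Ty Γ (univ i) (i + 1) := .univ (ctx_of_der hA)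
  have : Ty (univ i :: Γ) (trunc (var 0)) i := .trunc (der_var_zero hU)
  simpa using Der.substCongr e this

theorem ty_localEx_body (h : IsCollection Γ I T n l) (hS : Ty Γ S n) :
    Ty (I :: Γ) (arrow (app T.wk (var 0)) S.wk) l := by
  rw [wk_eq, wk_eq]
  exact ty_of_le h.le (ty_arrow h.ty_app_var (ty_wk h.ty hS))

theorem ty_sig_localEx (h : IsCollection Γ I T n l) (hS : Ty Γ S n) :
    Ty Γ (sig I (arrow (app T.wk (var 0)) S.wk)) l := .sig h.ty (ty_localEx_body h hS)

theorem ty_localEx (h : IsCollection Γ I T n l) (hS : Ty Γ S n) : Ty Γ (localEx I T S) l :=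
  .trunc (ty_sig_localEx h hS)

theorem inh_localEx (h : IsCollection Γ I T n l) (hS : Ty Γ S n) (ha : Der (.tm Γ a I))
    (hf : Inh Γ (arrow (app T a) S)) : Inh Γ (localEx I T S) :=
  inh_tr (ty_sig_localEx h hS)
    (hf.imp' _ fun _ hf => .pair (ty_localEx_body h hS) ha (by simpa using hf))

theorem inh_localEx_elim (h : IsCollection Γ I T n l) (hS : Ty Γ S n) (hC : Ty Γ C j)
    (hP : Inh Γ (isProp C)) (hx : Inh Γ (localEx I T S))
    (hf : Inh (arrow (app T.wk (var 0)) S.wk :: I :: Γ) (C.subst (shift 2))) : Inh Γ C := by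
  have hD := ty_sig_localEx h hS
  exact inh_ex_elim h.ty (ty_localEx_body h hS)
    (by simpa using ty_localEx_body (h.wk hD) (ty_wk hD hS)) hC hP hx hf

theorem inh_isProp_localEx (h : IsCollection Γ I T n l) (hS : Ty Γ S n) :
    Inh Γ (isProp (localEx I T S)) := inh_isProp_trunc (ty_sig_localEx h hS)

/-! Membership. -/

theorem ty_mem_body (h : IsCollection Γ I T n l) (hX : Ty Γ X n) :
    Ty (I :: Γ) (id (univ n) (app T.wk (var 0)) X.wk) (l + 1) := by
  rw [wk_eq, wk_eq]
  exact ty_of_le (Nat.succ_le_succ h.le)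
    (.id (.univ (.ctxCons h.ty)) h.ty_app_var (ty_wk h.ty hX))

/-- Membership speaks of identities between elements of `univ n`, hence the extra level. -/
theorem ty_mem (h : IsCollection Γ I T n l) (hX : Ty Γ X n) : Ty Γ (mem n I T X) (l + 1) :=
  ty_ex (.cumul h.ty) (ty_mem_body h hX)

theorem inh_mem (h : IsCollection Γ I T n l) (hX : Ty Γ X n) (ha : Der (.tm Γ a I))
    (e : Inh Γ (id (univ n) (app T a) X)) : Inh Γ (mem n I T X) :=
  inh_tr (.sig (.cumul h.ty) (ty_mem_body h hX))
    (e.imp' _ fun _ e => .pair (ty_mem_body h hX) ha (by simpa using e))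

theorem inh_mem_app (h : IsCollection Γ I T n l) (ha : Der (.tm Γ a I)) :
    Inh Γ (mem n I T (app T a)) :=
  inh_mem h (h.ty_app ha) ha ⟨_, .refl (.univ (ctx_of_der ha)) (h.ty_app ha)⟩

theorem inh_mem_elim (h : IsCollection Γ I T n l) (hX : Ty Γ X n) (hC : Ty Γ C j)
    (hP : Inh Γ (isProp C)) (hx : Inh Γ (mem n I T X))
    (hf : Inh (id (univ n) (app T.wk (var 0)) X.wk :: I :: Γ) (C.subst (shift 2))) :
    Inh Γ C := by
  have hD : Ty Γ (Tm.sig I (id (univ n) (app T.wk (var 0)) X.wk)) (l + 1) :=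
    .sig (.cumul h.ty) (ty_mem_body h hX)
  exact inh_ex_elim (.cumul h.ty) (ty_mem_body h hX)
    (by simpa using ty_mem_body (h.wk hD) (ty_wk hD hX)) hC hP hx hf

theorem inh_localEx_of_inh (h : IsProjPres Γ I T n l) (hS : Ty Γ S n) (hs : Inh Γ S) :
    Inh Γ (localEx I T S) := by
  have hc := h.coll
  have hu : Ty Γ Tm.unit n := .unit (ctx_of_der hS)
  have hb := ty_mem_body hc hu
  have hS2 := ty_wk_two hc.ty hb hS
  have hc2 := hc.wk_two hc.ty hb
  refine inh_mem_elim hc hu (ty_localEx hc hS) (inh_isProp_localEx hc hS) h.unit ?_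
  rw [subst_localEx]
  have v := der_var_one hc.ty hb
  -- A constant map exists out of any `T i`, so `1 ∈ T` serves here to provide an index.
  exact inh_localEx hc2 hS2 v
    (inh_arrow (inh_wk (hc2.ty_app v) (inh_wk_two hc.ty hb hs)))

/-! The use of projectivity. -/

/-- Projectivity for the constant family at `D`, with β-conversions before and after. Here `D` has
level `l`, not merely `n`. -/
theorem inh_trunc_arrow (h : IsProjPres Γ I T n l) (hA : Ty Γ A n) (hm : Inh Γ (mem n I T A))
    (hD : Ty Γ D l) (hf : Inh (A :: Γ) (trunc (D.subst (shift 1)))) :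
    Inh Γ (trunc (arrow A D)) := by
  have hU : Ty Γ (univ l) (l + 1) := .univ (ctx_of_der hA)
  have hA1 := ty_wk hA hA
  have hD1 := ty_wk hA hD
  have h1 := inh_app_pi h.proj hA
  simp only [subst_arrow, subst_mem, wk_eq, subst_subst, comp_shift_one_cons, subst_var,
    subst_isProjective, subst, cons_zero] at h1
  have hF : Der (.tm Γ (lam A (D.subst (shift 1))) (arrow A (univ l))) := der_lam hD1
  have h2 := inh_app_pi (inh_app h1 hm) hF
  have e : Der (.eq (A :: Γ) (app (lam (A.subst (shift 1)) (D.subst (shift 2))) (var 0))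
      (D.subst (shift 1)) (univ l)) := by
    simpa using eq_beta (B := univ l) (b := D.subst (shift 2)) (by simpa using ty_wk hA1 hD1)
      (der_var_zero hA)
  have ht : Ty (A :: Γ) (app (lam (A.subst (shift 1)) (D.subst (shift 2))) (var 0)) l := by
    have := der_wk hA hF
    rw [subst_arrow] at this
    simpa using der_app this (der_var_zero hA)
  have hA' := ty_of_le h.coll.le hA
  simp at h2
  have h3 := inh_app h2 (inh_pi (inh_conv hf (.eqSymm (eq_trunc ht e))))
  have := inh_conv h3 (eq_trunc (.pi hA' ht) (.piCongr (.eqRefl hA') e))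
  simpa [arrow] using this

/-! ### Gluing local witnesses over a total space -/

theorem inh_sig_localEx_snd (h : IsCollection Γ I T n l) (hS : Ty Γ S n)
    (hq : Der (.tm Γ q (sig I (arrow (app T.wk (var 0)) S.wk)))) :
    Inh Γ (arrow (app T (fst I q)) S) := by
  have hB := ty_localEx_body h hS
  have hD := ty_sig_localEx h hS
  have h2 := h.wk_two h.ty hB
  have hS2 := ty_wk_two h.ty hB hS
  have v1 := der_var_one h.ty hB
  have v0 := der_var_zero hB
  rw [subst_arrow] at v0
  have hp : Der (.tm (arrow (app T.wk (var 0)) S.wk :: I :: Γ)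
      (fst (I.subst (shift 2)) (pair (var 1) (var 0))) (I.subst (shift 2))) :=
    der_fst h2.ty (ty_localEx_body h2 hS2)
      (.pair (ty_localEx_body h2 hS2) v1 (by simpa using v0))
  -- On a pair, the motive mentions the first projection of that pair; this conversion identifies it
  -- with the first component, so that the second component has the required type.
  have e := eq_fst (b := var 0) h2.ty (ty_localEx_body h2 hS2) v1 (by simpa using v0)
  have e2 := eq_arrow_left (h2.ty_app v1) (eq_app_arg h2.ty h2.der (.eqSymm e)) hS2
  have hw := h.wk hD
  have hSw := ty_wk hD hS
  have hv : Der (.tm (sig I (arrow (app T.wk (var 0)) S.wk) :: Γ) (fst (I.subst (shift 1)) (var 0))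
      (I.subst (shift 1))) :=
    der_fst hw.ty (ty_localEx_body hw hSw) (by simpa using der_var_zero hD)
  have := Der.indSig
    (C := arrow (app (T.subst (shift 1)) (fst (I.subst (shift 1)) (var 0))) (S.subst (shift 1)))
    (g := var 0) (ty_arrow (hw.ty_app hv) hSw) (by simpa using Der.convTm v0 (by simpa using e2)) hq
  exact ⟨_, by simpa using this⟩

/-- Uncurrying. The family is a function `F` into the universe, so its formation can be derived
afresh after weakening. -/
theorem inh_arrow_sig (hA : Ty Γ A n) (hS : Ty Γ S n) (hF : Der (.tm Γ F (arrow A (univ n))))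
    (hK : Inh Γ (pi A (arrow (app (F.subst (shift 1)) (var 0)) (S.subst (shift 1))))) :
    Inh Γ (arrow (sig A (app (F.subst (shift 1)) (var 0))) S) := by
  have tyB : ∀ {Γ A F}, Ty Γ A n → Der (.tm Γ F (arrow A (univ n))) →
      Ty (A :: Γ) (app (F.subst (shift 1)) (var 0)) n := by
    intro Γ A F hA hF
    have := der_wk hA hF
    rw [subst_arrow] at this
    exact der_app this (der_var_zero hA)
  have hB := tyB hA hF
  have hD := Der.sig hA hB
  have hA1 := ty_wk hD hA
  have hF1 := der_wk hD hF
  rw [subst_arrow] at hF1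
  have hB1 := tyB hA1 hF1
  have hK3 := inh_wk_two hA1 hB1 (inh_wk hD hK)
  refine inh_arrow (inh_sig_elim hA1 hB1 (ty_wk hD hS) ⟨var 0, by simpa using der_var_zero hD⟩
    (inh_app (A := app (F.subst (shift 3)) (var 1)) ?_ ⟨var 0, ?_⟩))
  · have := inh_app_pi (Γ := app ((F.subst (shift 1)).subst (shift 1)) (var 0) ::
      A.subst (shift 1) :: Tm.sig A (app (F.subst (shift 1)) (var 0)) :: Γ) hK3
      (der_var_one hA1 hB1)
    simpa using this
  · simpa using der_var_zero hB1

/-- The function is weakened past the variable it is applied to, so the body must be typed with that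
variable inserted below its own; the hypothesis supplies this. -/
theorem eq_beta_var (hA : Ty Γ A i)
    (hb : Der (.tm (A.subst (shift 1) :: A :: Γ) (b.subst (cons (var 0) (shift 2)))
      (B.subst (shift 2)))) :
    Der (.eq (A :: Γ) (app ((lam A b).subst (shift 1)) (var 0)) b (B.subst (shift 1))) := by
  have := eq_beta (b := b.subst (cons (var 0) (shift 2))) (B := B.subst (shift 1))
    (by simpa using hb) (der_var_zero hA)
  simpa using this

theorem der_fst_app (h : IsCollection Γ I T n l) (hS : Ty Γ S n) (hA : Ty Γ A i)
    (hp : Der (.tm Γ p (arrow A (sig I (arrow (app T.wk (var 0)) S.wk))))) :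
    Der (.tm (A :: Γ) (fst (I.subst (shift 1)) (app (p.subst (shift 1)) (var 0)))
      (I.subst (shift 1))) := by
  have hp1 := der_wk hA hp
  rw [subst_arrow] at hp1
  exact der_fst (h.wk hA).ty (ty_localEx_body (h.wk hA) (ty_wk hA hS))
    (by simpa using der_app hp1 (der_var_zero hA))

theorem IsCollection.ty_app_app (h : IsCollection Γ I T n l) (hA : Ty Γ A i)
    (hJ : Der (.tm Γ f (arrow A I))) :
    Ty (A :: Γ) (app (T.subst (shift 1)) (app (f.subst (shift 1)) (var 0))) n := by
  have hJ1 := der_wk hA hJ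
  rw [subst_arrow] at hJ1
  exact (h.wk hA).ty_app (der_app hJ1 (der_var_zero hA))

/-- The step where closure under sums enters. The first components of `p` form `J : T a → I`, the
second components are maps `T (J x) → S`, and the total space `Σ x, T (J x)` is a single member of
`T` mapping to `S`. -/
theorem inh_localEx_of_fun (h : IsProjPres Γ I T n l) (hS : Ty Γ S n) (ha : Der (.tm Γ a I))
    (hp : Inh Γ (arrow (app T a) (sig I (arrow (app T.wk (var 0)) S.wk)))) :
    Inh Γ (localEx I T S) := by
  obtain ⟨p, hp⟩ := hp
  have hc := h.coll
  have hA := hc.ty_app ha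
  have hA1 := ty_wk hA hA
  have h1 := hc.wk hA
  have hS1 := ty_wk hA hS
  have w := der_var_zero hA
  have hp1 := der_wk hA hp
  rw [subst_arrow] at hp1
  have hq : Der (.tm (app T a :: Γ) (app (p.subst (shift 1)) (var 0))
      (Tm.sig (I.subst (shift 1)) (arrow (app (T.subst (shift 1)).wk (var 0))
        (S.subst (shift 1)).wk))) := by
    simpa using der_app hp1 w
  have hj := der_fst_app hc hS hA hp
  have hJ := der_lam hj
  -- `J` is kept opaque so that `simp` does not unfold it; what is used of its value is the
  -- conversion `eJ`. The same is done for `F` below.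
  obtain ⟨J, hJe⟩ : ∃ J, J = lam (app T a) (fst (I.subst (shift 1))
    (app (p.subst (shift 1)) (var 0))) := ⟨_, rfl⟩
  rw [← hJe] at hJ
  have hJ1 := der_wk hA hJ
  rw [subst_arrow] at hJ1
  have hJv := der_app hJ1 w
  have eJ : Der (.eq (app T a :: Γ) (app (J.subst (shift 1)) (var 0))
      (fst (I.subst (shift 1)) (app (p.subst (shift 1)) (var 0))) (I.subst (shift 1))) := by
    rw [hJe]
    exact eq_beta_var hA (by
      have := der_fst_app h1 hS1 hA1 (p := p.subst (shift 1)) (by simpa using hp1)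
      simpa using this)
  have hF1 := h1.ty_app hJv
  have hF := der_lam (B := univ n) hF1
  have eF : Der (.eq (app T a :: Γ)
      (app ((lam (app T a) (app (T.subst (shift 1)) (app (J.subst (shift 1)) (var 0)))).subst
        (shift 1)) (var 0))
      (app (T.subst (shift 1)) (app (J.subst (shift 1)) (var 0))) (univ n)) :=
    eq_beta_var (B := univ n) hA (by simpa using h1.ty_app_app hA1 hJ1)
  obtain ⟨F, hFe⟩ : ∃ F, F = lam (app T a) (app (T.subst (shift 1))
    (app (J.subst (shift 1)) (var 0))) := ⟨_, rfl⟩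
  rw [← hFe] at hF eF
  have hFw := der_wk hA hF
  rw [subst_arrow] at hFw
  have hFv : Ty (app T a :: Γ) (app (F.subst (shift 1)) (var 0)) n := der_app hFw w
  -- the map out of the total space
  have hK := inh_arrow_sig hA hS hF (inh_pi (inh_conv (inh_sig_localEx_snd h1 hS1 hq)
    (.eqTrans (eq_arrow_left (h1.ty_app hj) (eq_app_arg h1.ty h1.der (.eqSymm eJ)) hS1)
      (eq_arrow_left hF1 (.eqSymm eF) hS1))))
  -- the total space is a member of `T`
  have hm1 : Inh (app T a :: Γ) (mem n (I.subst (shift 1)) (T.subst (shift 1))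
      (app (F.subst (shift 1)) (var 0))) :=
    inh_mem h1 hFv hJv (inh_conv ⟨_, .refl (.univ (ctx_of_der hF1)) hF1⟩
      (eq_id_right (.univ (ctx_of_der hF1)) hF1 (.eqSymm eF)))
  have hs := inh_app_pi h.sig hA
  simp only [subst] at hs
  have hs := inh_app_pi hs (by simpa using hF)
  simp at hs
  have hm := inh_app (inh_app hs (inh_mem_app hc ha)) (inh_pi hm1)
  have hD := Der.sig hA hFv
  have hb := ty_mem_body hc hD
  -- Membership yields an index `k` with `T k` equal to the total space; that identity gives a map
  -- from `T k` to the total space, to be followed by the map to `S`.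
  refine inh_mem_elim hc hD (ty_localEx hc hS) (inh_isProp_localEx hc hS) hm ?_
  have hc2 := hc.wk_two hc.ty hb
  have v := der_var_one hc.ty hb
  rw [subst_localEx]
  refine inh_localEx hc2 (ty_wk_two hc.ty hb hS) v (inh_comp (hc2.ty_app v)
    (inh_arrow_of_id (hc2.ty_app v) (ty_wk_two hc.ty hb hD) ⟨var 0, ?_⟩) ?_)
  · simpa using der_var_zero hb
  · simpa using inh_wk_two hc.ty hb hK

/-- Restricting along `T a → ‖T a‖` gives a family of truncated choices over `T a`, and projectivity
moves the truncation outside. Since the goal is a proposition, an actual choice function may then be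
assumed. -/
theorem inh_localEx_of_cover (h : IsProjPres Γ I T n l) (hS : Ty Γ S n) (ha : Der (.tm Γ a I))
    (hf : Inh Γ (arrow (trunc (app T a)) (localEx I T S))) : Inh Γ (localEx I T S) := by
  have hc := h.coll
  have hA := hc.ty_app ha
  have hD := ty_sig_localEx hc hS
  have hf1 := inh_wk hA hf
  rw [subst_arrow] at hf1
  have h1 := inh_trunc_arrow h hA (inh_mem_app hc ha) hD
    (inh_app hf1 ⟨_, .tr (ty_wk hA hA) (der_var_zero hA)⟩)
  have hAD := ty_arrow (ty_of_le hc.le hA) hD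
  refine inh_trunc_elim hAD (ty_localEx hc hS) (inh_isProp_localEx hc hS) h1 ?_
  rw [subst_localEx]
  exact inh_localEx_of_fun (h.wk hAD) (ty_wk hAD hS) (der_wk hAD ha)
    ⟨var 0, by simpa using der_var_zero hAD⟩

/-- For a proposition only the map back from the cover must be supplied, which is the gluing just
proved. -/
theorem inh_isSheaf_localEx (h : IsProjPres Γ I T n l) (hS : Ty Γ S n) :
    Inh Γ (isSheaf I T (localEx I T S)) := by
  have hc := h.coll
  have hR := ty_localEx hc hS
  have hI := hc.ty
  refine inh_isSheaf_of_isProp hc hR (inh_isProp_localEx hc hS) ?_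
  have hB := ty_arrow (by simpa using hc.ty_trunc) (ty_wk hI hR)
  rw [subst_localEx I T S (shift 2)]
  refine inh_localEx_of_cover (h.wk_two hI hB) (ty_wk_two hI hB hS) (der_var_one hI hB)
    ⟨var 0, ?_⟩
  simpa using der_var_zero hB

/-- Sheafification agrees with local existence. -/
theorem inh_localEx_of_sheafify (h : IsProjPres Γ I T n l) (hS : Ty Γ S n) :
    Inh Γ (arrow (sheafify I T (trunc S)) (localEx I T S)) := by
  have hc := h.coll
  have hS' : Ty Γ (trunc S) n := .trunc hS
  have h1 := h.wk hS'
  have hS1 := ty_wk hS' hS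
  have hS2 := ty_wk hS1 hS1
  -- The target is a sheaf, so the map need only be given on `‖S‖`; it is a proposition, so an
  -- element of `S` may be assumed.
  refine inh_sheafify_rec hc (ty_of_le hc.le hS') (ty_localEx hc hS)
    (inh_isSheaf_localEx h hS) (inh_arrow ?_)
  rw [subst_localEx]
  refine inh_trunc_elim hS1 (ty_localEx h1.coll hS1) (inh_isProp_localEx h1.coll hS1)
    ⟨var 0, by simpa using der_var_zero hS'⟩ ?_
  rw [subst_localEx]
  exact inh_localEx_of_inh (h1.wk hS1) hS2 ⟨_, der_var_zero hS1⟩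

/-- Only the sheaf condition and propositionality of the sheafification enter: a map `T i → S`
yields an element of it over `‖T i‖`, which then descends. -/
theorem inh_sheafify_of_localEx (h : IsCollection Γ I T n l) (hS : Ty Γ S n) :
    Inh Γ (arrow (localEx I T S) (sheafify I T (trunc S))) := by
  have main : ∀ {Γ I T S a}, IsCollection Γ I T n l → Ty Γ S n → Der (.tm Γ a I) →
      Inh Γ (arrow (app T a) S) → Inh Γ (sheafify I T (trunc S)) := by
    intro Γ I T S a h hS ha hf
    have hS' : Ty Γ (trunc S) l := ty_of_le h.le (.trunc hS)
    have hN := ty_sheafify h hS'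
    have hA := h.ty_app ha
    refine inh_of_isSheaf h hN (inh_isSheaf_sheafify h hS') ha (inh_arrow ?_)
    have hA' : Ty Γ (trunc (app T a)) n := .trunc hA
    have hA1 := ty_wk hA' hA
    refine inh_trunc_elim hA1 (ty_wk hA' hN) ?_ ⟨var 0, by simpa using der_var_zero hA'⟩ ?_
    · simpa using inh_wk hA' (inh_isProp_sheafify h hS' (inh_isProp_trunc hS))
    · have hf2 := inh_wk hA1 (inh_wk hA' hf)
      rw [subst_arrow, subst_arrow] at hf2
      obtain ⟨s, hs⟩ := inh_app hf2 ⟨_, der_var_zero hA1⟩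
      have h2 := (h.wk hA').wk hA1
      have hS2 := ty_wk hA1 (ty_wk hA' hS)
      rw [subst_sheafify, subst_sheafify]
      exact ⟨_, der_sheafUnit h2 (ty_of_le h.le (.trunc hS2)) (.tr hS2 hs)⟩
  have hR := ty_localEx h hS
  have hS' : Ty Γ (trunc S) l := ty_of_le h.le (.trunc hS)
  have h1 := h.wk hR
  have hS1 := ty_wk hR hS
  refine inh_arrow (inh_localEx_elim h1 hS1 (ty_wk hR (ty_sheafify h hS')) ?_ ⟨var 0, ?_⟩ ?_)
  · simpa using inh_wk hR (inh_isProp_sheafify h hS' (inh_isProp_trunc hS))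
  · simpa using der_var_zero hR
  · have hb := ty_localEx_body h1 hS1
    have := main (h1.wk_two h1.ty hb) (ty_wk_two h1.ty hb hS1) (der_var_one h1.ty hb)
      ⟨var 0, by simpa using der_var_zero hb⟩
    simpa using this

end presentations

/-! Predicates and local witnesses. -/

/-- `Σ x : X, P x`. -/
def witness (n : ℕ) (X P : Tm) : Tm := sig X (holds n (app P.wk (var 0)))

/-- The proofs that `x : A → X` satisfies `P` pointwise, with `x` the last variable. -/
def pointwise (n : ℕ) (A P : Tm) : Tm :=
  pi A.wk (holds n (app (P.wkn 2) (app (var 1) (var 0))))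

/-- `∃ x : A → X, Π a : A, P (x a)`. -/
def famEx (n : ℕ) (A X P : Tm) : Tm := ex (arrow A X) (pointwise n A P)

/-- `∃ i : I, ∃ x : T i → X, Π a : T i, P (x a)`. -/
def forces (n : ℕ) (I T X P : Tm) : Tm := ex I (famEx n (app T.wk (var 0)) X.wk P.wk)

@[simp] theorem subst_witness (n : ℕ) (X P : Tm) (s : ℕ → Tm) :
    (witness n X P).subst s = witness n (X.subst s) (P.subst s) := by simp [witness]

@[simp] theorem subst_famEx (n : ℕ) (A X P : Tm) (s : ℕ → Tm) :
    (famEx n A X P).subst s = famEx n (A.subst s) (X.subst s) (P.subst s) := by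
  simp [famEx, pointwise]

@[simp] theorem subst_forces (n : ℕ) (I T X P : Tm) (s : ℕ → Tm) :
    (forces n I T X P).subst s = forces n (I.subst s) (T.subst s) (X.subst s) (P.subst s) := by
  simp [forces]

section predicates

variable {Γ : Ctx} {I T A B C P S X a b c f g p t x : Tm} {i j l m n : ℕ}

theorem ty_isProp (hA : Ty Γ A i) : Ty Γ (isProp A) i := by
  have hA1 := ty_wk hA hA
  have v0 := der_var_zero hA1
  simp only [subst_subst, comp_shift_shift, Nat.reduceAdd] at v0
  rw [isProp, wk_eq, wkn_eq]
  exact .pi hA (.pi hA1 (.id (ty_wk_two hA hA1 hA) (der_var_one hA hA1) v0))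

theorem ty_propU_body (hΓ : Der (.ctx Γ)) : Ty (univ n :: Γ) (isProp (var 0)) (n + 1) :=
  .cumul (ty_isProp (der_var_zero (.univ hΓ)))

theorem ty_propU (hΓ : Der (.ctx Γ)) : Ty Γ (propU n) (n + 1) :=
  .sig (.univ hΓ) (ty_propU_body hΓ)

theorem ty_holds (hp : Der (.tm Γ p (propU n))) : Ty Γ (holds n p) n :=
  der_fst (.univ (ctx_of_der hp)) (ty_propU_body (ctx_of_der hp)) hp

theorem ty_holds_app (hP : Der (.tm Γ f (arrow X (propU n)))) (hx : Der (.tm Γ x X)) :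
    Ty Γ (holds n (app f x)) n := ty_holds (der_app hP hx)

theorem der_wk_pred (hA : Ty Γ A i) (hP : Der (.tm Γ P (arrow X (propU n)))) :
    Der (.tm (A :: Γ) (P.subst (shift 1)) (arrow (X.subst (shift 1)) (propU n))) := by
  simpa using der_wk hA hP

theorem der_wk_two_pred (hA : Ty Γ A i) (hB : Ty (A :: Γ) B j)
    (hP : Der (.tm Γ P (arrow X (propU n)))) :
    Der (.tm (B :: A :: Γ) (P.subst (shift 2)) (arrow (X.subst (shift 2)) (propU n))) := by
  simpa using der_wk_two hA hB hP

theorem eq_holds_app (hX : Ty Γ X i) (hP : Der (.tm Γ P (arrow X (propU n))))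
    (e : Der (.eq Γ a b X)) :
    Der (.eq Γ (holds n (app P a)) (holds n (app P b)) (univ n)) := by
  simpa using Der.substCongr e (ty_holds_app (der_wk_pred hX hP) (der_var_zero hX))

theorem ty_witness_body (hX : Ty Γ X n) (hP : Der (.tm Γ P (arrow X (propU n)))) :
    Ty (X :: Γ) (holds n (app P.wk (var 0))) n := by
  rw [wk_eq]
  exact ty_holds_app (der_wk_pred hX hP) (der_var_zero hX)

theorem ty_witness (hX : Ty Γ X n) (hP : Der (.tm Γ P (arrow X (propU n)))) :
    Ty Γ (witness n X P) n := .sig hX (ty_witness_body hX hP)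

theorem ty_pointwise (hA : Ty Γ A n) (hX : Ty Γ X n) (hP : Der (.tm Γ P (arrow X (propU n)))) :
    Ty (arrow A X :: Γ) (pointwise n A P) n := by
  have h0 := ty_arrow hA hX
  have hA1 := ty_wk h0 hA
  have v1 := der_var_one h0 hA1
  have v0 := der_var_zero hA1
  rw [subst_arrow] at v1
  simp only [subst_subst, comp_shift_shift, Nat.reduceAdd] at v0
  rw [pointwise, wk_eq, wkn_eq]
  exact .pi hA1 (ty_holds_app (der_wk_two_pred h0 hA1 hP) (der_app v1 v0))

theorem ty_famEx (hA : Ty Γ A n) (hX : Ty Γ X n) (hP : Der (.tm Γ P (arrow X (propU n)))) :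
    Ty Γ (famEx n A X P) n := ty_ex (ty_arrow hA hX) (ty_pointwise hA hX hP)

theorem der_witness_fst (hX : Ty Γ X n) (hP : Der (.tm Γ P (arrow X (propU n))))
    (hp : Der (.tm Γ p (witness n X P))) : Der (.tm Γ (fst X p) X) :=
  der_fst hX (ty_witness_body hX hP) hp

theorem inh_witness_snd (hX : Ty Γ X n) (hP : Der (.tm Γ P (arrow X (propU n))))
    (hp : Der (.tm Γ p (witness n X P))) : Inh Γ (holds n (app P (fst X p))) := by
  have hB := ty_witness_body hX hP
  have hS := ty_witness hX hP
  have hX2 := ty_wk_two hX hB hX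
  have hP2 := der_wk_two_pred hX hB hP
  have v0 := der_var_zero hB
  have e := eq_fst (b := var 0) hX2 (ty_witness_body hX2 hP2) (der_var_one hX hB)
    (by simpa using v0)
  have e2 := eq_holds_app hX2 hP2 (.eqSymm e)
  have hv : Der (.tm (witness n X P :: Γ) (fst (X.subst (shift 1)) (var 0)) (X.subst (shift 1))) :=
    der_witness_fst (ty_wk hS hX) (der_wk_pred hS hP) (by simpa using der_var_zero hS)
  have := Der.indSig
    (C := holds n (app (P.subst (shift 1)) (fst (X.subst (shift 1)) (var 0))))
    (g := var 0) (ty_holds_app (der_wk_pred hS hP) hv)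
    (by simpa using Der.convTm v0 (by simpa using e2)) hp
  exact ⟨_, by simpa using this⟩

/-- A family of witnesses is a function together with a pointwise proof. -/
theorem inh_famEx (hA : Ty Γ A n) (hX : Ty Γ X n) (hP : Der (.tm Γ P (arrow X (propU n))))
    (hf : Inh Γ (arrow A (witness n X P))) : Inh Γ (famEx n A X P) := by
  obtain ⟨f, hf⟩ := hf
  have fam : ∀ {Γ A X P f}, Ty Γ A n → Ty Γ X n → Der (.tm Γ P (arrow X (propU n))) →
      Der (.tm Γ f (arrow A (witness n X P))) →
      Der (.tm (A :: Γ) (app (f.subst (shift 1)) (var 0))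
        (witness n (X.subst (shift 1)) (P.subst (shift 1)))) := by
    intro Γ A X P f hA hX hP hf
    have hf1 := der_wk hA hf
    rw [subst_arrow, subst_witness] at hf1
    exact der_app hf1 (der_var_zero hA)
  have hX1 := ty_wk hA hX
  have hA1 := ty_wk hA hA
  have hP1 := der_wk_pred hA hP
  have hw := fam hA hX hP hf
  have hx := der_witness_fst hX1 hP1 hw
  have hf1 := der_wk hA hf
  rw [subst_arrow, subst_witness] at hf1
  have hx1 := der_witness_fst (ty_wk hA1 hX1) (der_wk_pred hA1 hP1) (fam hA1 hX1 hP1 hf1)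
  -- The second projection proves `P` at `fst (f a)`, whereas the pointwise statement asks for `P`
  -- at the abstracted function applied to `a`; the two agree by this β-conversion.
  have e := eq_beta_var (b := fst (X.subst (shift 1)) (app (f.subst (shift 1)) (var 0))) (B := X)
    hA (by simpa using hx1)
  obtain ⟨y, hy⟩ := inh_pi (inh_conv (inh_witness_snd hX1 hP1 hw)
    (eq_holds_app hX1 hP1 (.eqSymm e)))
  exact ⟨_, .tr (.sig (ty_arrow hA hX) (ty_pointwise hA hX hP))
    (.pair (ty_pointwise hA hX hP) (der_lam hx) (by simpa [pointwise] using hy))⟩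

/-- The converse passage, in eliminated form: `x` and a pointwise proof `y` combine to the family `a
↦ (x a, y a)` of witnesses. -/
theorem inh_famEx_elim (hA : Ty Γ A n) (hX : Ty Γ X n) (hP : Der (.tm Γ P (arrow X (propU n))))
    (hC : Ty Γ C j) (hPC : Inh Γ (isProp C)) (hx : Inh Γ (famEx n A X P))
    (hf : Inh Γ (arrow (arrow A (witness n X P)) C)) : Inh Γ C := by
  have h0 := ty_arrow hA hX
  have h1 := ty_pointwise hA hX hP
  have hD := Der.sig h0 h1
  refine inh_ex_elim h0 h1 ?_ hC hPC hx ?_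
  · simpa [pointwise] using ty_pointwise (ty_wk hD hA) (ty_wk hD hX) (der_wk_pred hD hP)
  · have hf2 := inh_wk_two h0 h1 hf
    rw [subst_arrow] at hf2
    refine inh_app hf2 ?_
    rw [subst_arrow, subst_witness]
    have hA2 := ty_wk_two h0 h1 hA
    have w1 := der_wk hA2 (der_var_one h0 h1)
    have w0 := der_wk hA2 (der_var_zero h1)
    have w := der_var_zero hA2
    rw [subst_arrow, subst_arrow] at w1
    have hX3 := ty_wk hA2 (ty_wk_two h0 h1 hX)
    have hP3 := der_wk_pred hA2 (der_wk_two_pred h0 h1 hP)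
    have hx := der_app w1 w
    -- In the context with `a`, `y`, `x` as variables `0`, `1`, `2`, the function `x` becomes
    -- variable `3` under the product.
    have e : ((pointwise n A P).subst (shift 1)).subst (shift 1) = pi (A.subst (shift 3))
        (holds n (app (P.subst (shift 4)) (app (var 3) (var 0)))) := by simp [pointwise]
    rw [e] at w0
    rw [subst_subst A, comp_shift_shift] at w
    have hy := der_app_pi
      (B := holds n (app (P.subst (shift 4)) (app (var 3) (var 0))))
      (C := (holds n (app ((P.subst (shift 2)).subst (shift 1)).wk (var 0))).inst
        (app ((var 1).subst (shift 1)) (var 0)))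
      w0 w (by simp)
    have hp := Der.pair (ty_witness_body hX3 hP3) hx hy
    exact inh_arrow (by rw [subst_witness]; exact ⟨_, hp⟩)

theorem ty_forces_body (h : IsCollection Γ I T n l) (hX : Ty Γ X n)
    (hP : Der (.tm Γ P (arrow X (propU n)))) :
    Ty (I :: Γ) (famEx n (app T.wk (var 0)) X.wk P.wk) l := by
  simp only [wk_eq]
  exact ty_of_le h.le (ty_famEx h.ty_app_var (ty_wk h.ty hX) (der_wk_pred h.ty hP))

theorem ty_forces (h : IsCollection Γ I T n l) (hX : Ty Γ X n)
    (hP : Der (.tm Γ P (arrow X (propU n)))) : Ty Γ (forces n I T X P) l :=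
  ty_ex h.ty (ty_forces_body h hX hP)

theorem inh_isProp_forces (h : IsCollection Γ I T n l) (hX : Ty Γ X n)
    (hP : Der (.tm Γ P (arrow X (propU n)))) : Inh Γ (isProp (forces n I T X P)) :=
  inh_isProp_trunc (.sig h.ty (ty_forces_body h hX hP))

/-! ### Local existence and the right-hand side -/

theorem inh_forces_of_localEx (h : IsCollection Γ I T n l) (hX : Ty Γ X n)
    (hP : Der (.tm Γ P (arrow X (propU n)))) :
    Inh Γ (arrow (localEx I T (witness n X P)) (forces n I T X P)) := by
  have hS := ty_witness hX hP
  have hR := ty_localEx h hS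
  have h1 := h.wk hR
  have hX1 := ty_wk hR hX
  have hP1 := der_wk_pred hR hP
  have hS1 := ty_witness hX1 hP1
  have hF1 := ty_forces h1 hX1 hP1
  have hb := ty_localEx_body h1 hS1
  have h2 := h1.wk_two h1.ty hb
  have hX2 := ty_wk_two h1.ty hb hX1
  have hP2 := der_wk_two_pred h1.ty hb hP1
  have v := der_var_one h1.ty hb
  refine inh_arrow ?_
  rw [subst_forces]
  refine inh_localEx_elim h1 hS1 hF1 (inh_isProp_forces h1 hX1 hP1)
    ⟨var 0, by simpa using der_var_zero hR⟩ ?_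
  rw [subst_forces]
  obtain ⟨t, ht⟩ := inh_famEx (h2.ty_app v) hX2 hP2 ⟨var 0, by simpa using der_var_zero hb⟩
  exact ⟨_, .tr (.sig h2.ty (ty_forces_body h2 hX2 hP2))
    (.pair (ty_forces_body h2 hX2 hP2) v (by simpa using ht))⟩

theorem inh_localEx_of_forces (h : IsCollection Γ I T n l) (hX : Ty Γ X n)
    (hP : Der (.tm Γ P (arrow X (propU n)))) :
    Inh Γ (arrow (forces n I T X P) (localEx I T (witness n X P))) := by
  have hR := ty_forces h hX hP
  have h1 := h.wk hR
  have hX1 := ty_wk hR hX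
  have hP1 := der_wk_pred hR hP
  have hS1 := ty_witness hX1 hP1
  have hL1 := ty_localEx h1 hS1
  have hb := ty_forces_body h1 hX1 hP1
  have hD := Der.sig h1.ty hb
  have h2 := h1.wk_two h1.ty hb
  have hX2 := ty_wk_two h1.ty hb hX1
  have hP2 := der_wk_two_pred h1.ty hb hP1
  have hS2 := ty_witness hX2 hP2
  have v := der_var_one h1.ty hb
  refine inh_arrow ?_
  rw [subst_localEx, subst_witness]
  refine inh_ex_elim h1.ty hb ?_ hL1 (inh_isProp_localEx h1 hS1)
    ⟨var 0, by simpa [forces] using der_var_zero hR⟩ ?_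
  · simpa using ty_forces_body (h1.wk hD) (ty_wk hD hX1) (der_wk_pred hD hP1)
  · rw [subst_localEx, subst_witness]
    refine inh_famEx_elim (h2.ty_app v) hX2 hP2 (ty_localEx h2 hS2) (inh_isProp_localEx h2 hS2)
      ⟨var 0, by simpa using der_var_zero hb⟩ (inh_arrow ?_)
    have hG := ty_arrow (h2.ty_app v) hS2
    rw [subst_localEx]
    exact inh_localEx (h2.wk hG) (ty_wk hG hS2) (der_wk hG v)
      ⟨var 0, by simpa using der_var_zero hG⟩

/-- Sheafified existence is local existence. -/
theorem inh_id_sheafify_forces (h : IsProjPres Γ I T n l) (hX : Ty Γ X n)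
    (hP : Der (.tm Γ P (arrow X (propU n)))) :
    Inh Γ (id (univ l) (sheafify I T (trunc (witness n X P))) (forces n I T X P)) := by
  have hc := h.coll
  have hS := ty_witness hX hP
  have hS' : Ty Γ (trunc (witness n X P)) l := ty_of_le hc.le (.trunc hS)
  have hN := ty_sheafify hc hS'
  have hF := ty_forces hc hX hP
  -- Both composites pass through local existence for the type of witnesses.
  exact inh_id_univ_of_isProp hN hF (inh_isProp_sheafify hc hS' (inh_isProp_trunc hS))
    (inh_isProp_forces hc hX hP)
    (inh_comp hN (inh_localEx_of_sheafify h hS) (inh_forces_of_localEx hc hX hP))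
    (inh_comp hF (inh_localEx_of_forces hc hX hP) (inh_sheafify_of_localEx hc hS))

/-! Formation of the hypothesis and the theorem. -/

/-- Formation is needed because a hypothesis can enter a context, and a pair can be projected, only
once the types involved are derived. The level is `l + 1` since the type quantifies over families in
`univ l`. -/
theorem ty_isProjective (hX : Ty Γ X n) (hl : n ≤ l) : Ty Γ (isProjective l X) (l + 1) := by
  have hX' : Ty Γ X (l + 1) := ty_of_le (Nat.le_succ_of_le hl) hX
  have h0 : Ty Γ (arrow X (univ l)) (l + 1) := ty_arrow hX' (.univ (ctx_of_der hX))
  have hX1 := ty_wk h0 hX'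
  have v1 := der_var_one h0 hX1
  have v0 := der_var_zero hX1
  simp only [subst_arrow, subst_subst, comp_shift_shift, Nat.reduceAdd] at v0 v1
  have ha : Ty (X.subst (shift 1) :: arrow X (univ l) :: Γ) (app (var 1) (var 0)) l :=
    der_app v1 v0
  rw [isProjective, wk_eq]
  exact .pi h0 (ty_arrow (.pi hX1 (.cumul (.trunc ha))) (.trunc (.pi hX1 (.cumul ha))))

theorem ty_membersProjective (h : IsCollection Γ I T n l) :
    Ty Γ (membersProjective n l I T) (l + 1) := by
  have hU : Ty Γ (univ n) (n + 1) := .univ (ctx_of_der h.ty)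
  have v := der_var_zero hU
  rw [membersProjective, wk_eq, wk_eq]
  exact .pi (ty_of_le (Nat.succ_le_succ h.le) hU)
    (ty_arrow (ty_mem (h.wk hU) v) (ty_isProjective v h.le))

theorem ty_sigClosed (h : IsCollection Γ I T n l) : Ty Γ (sigClosed n I T) (l + 1) := by
  have hU : Ty Γ (univ n) (n + 1) := .univ (ctx_of_der h.ty)
  have hv : Ty (univ n :: Γ) (var 0) n := der_var_zero hU
  have hF : Ty (univ n :: Γ) (arrow (var 0) (univ n)) (n + 1) :=
    ty_arrow (.cumul hv) (ty_univ hU)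
  have h2 := h.wk_two hU hF
  have v1 : Ty (arrow (var 0) (univ n) :: univ n :: Γ) (var 1) n := der_var_one hU hF
  have w1 := der_wk v1 (der_var_zero hF)
  have w0 := der_var_zero v1
  simp only [subst_arrow, subst, shift_zero_apply, shift_one_apply, Nat.reduceAdd] at w0 w1
  have ha : Ty (var 1 :: arrow (var 0) (univ n) :: univ n :: Γ) (app (var 1) (var 0)) n :=
    der_app w1 w0
  have h3 := h2.wk v1
  have hle := Nat.succ_le_succ h.le
  have hm := ty_mem h3 ha
  simp only [subst_subst, comp_shift_shift, Nat.reduceAdd] at hm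
  simp only [sigClosed, wkn_eq]
  exact .pi (ty_of_le hle hU) (.pi (ty_of_le hle hF) (ty_arrow (ty_mem h2 v1)
    (ty_arrow (.pi (ty_of_le (Nat.le_succ_of_le h.le) v1) hm) (ty_mem h2 (.sig v1 ha)))))

theorem ty_isPresentation (h : IsCollection Γ I T n l) :
    Ty Γ (prod (mem n I T Tm.unit) (sigClosed n I T)) (l + 1) :=
  ty_prod (ty_mem h (.unit (ctx_of_der h.ty))) (ty_sigClosed h)

theorem ty_isProjPresentation (h : IsCollection Γ I T n (max m n)) :
    Ty Γ (isProjPresentation m n I T) (max m n + 1) :=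
  ty_prod (ty_isPresentation h) (ty_membersProjective h)

/-- `sigClosed` and `membersProjective` name the components of the two nested products, so the
projections apply directly. -/
theorem isProjPres_of_inh (h : IsCollection Γ I T n (max m n))
    (hT : Inh Γ (isProjPresentation m n I T)) : IsProjPres Γ I T n (max m n) := by
  have h1 := ty_isPresentation h
  have h2 := ty_membersProjective h
  have hu := ty_mem h (.unit (ctx_of_der h.ty))
  have hp := inh_prod_fst h1 h2 hT
  exact ⟨h, inh_prod_fst hu (ty_sigClosed h) hp, inh_prod_snd hu (ty_sigClosed h) hp,
    inh_prod_snd h1 h2 hT⟩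

end predicates

end HoTT

/-! ### The closed statement -/

theorem mainTheorem3 (m n : ℕ) : HoTT.Holds (HoTT.Tm.kripkeJoyal m n) := by
  open HoTT HoTT.Tm in
  have hU : Ty [] (univ m) (m + 1) := .univ .ctxNil
  have hI : Ty [univ m] (var 0) m := der_var_zero hU
  have hF : Ty [univ m] (arrow (var 0) (univ n)) (max m n + 1) :=
    ty_arrow (ty_of_le (Nat.le_succ_of_le (le_max_left m n)) hI)
      (ty_of_le (Nat.succ_le_succ (le_max_right m n)) (ty_univ hU))
  -- Cumulativity raises `I` from level `m` to `max m n`, where the index type, the members and the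
  -- sheafification all live.
  have hc : IsCollection [arrow (var 0) (univ n), univ m] (var 1) (var 0) n (max m n) :=
    ⟨ty_of_le (le_max_left m n) (der_wk hF hI), by simpa using der_var_zero hF, le_max_right m n⟩
  have hH := ty_isProjPresentation hc
  have h3 := isProjPres_of_inh (hc.wk hH) ⟨var 0, by simpa using der_var_zero hH⟩
  have hV := Der.univ (i := n) (ctx_of_der h3.coll.ty)
  have h4 := h3.wk hV
  have hX := der_var_zero hV
  have hQ := ty_arrow (.cumul hX) (ty_propU (n := n) (ctx_of_der hX))
  have h5 := inh_id_sheafify_forces (P := var 0) (h4.wk hQ) (der_wk hQ hX)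
    (by simpa using der_var_zero hQ)
  refine inh_pi (inh_pi (inh_pi (inh_pi (inh_pi ?_))))
  -- Unfolding the abbreviations and normalising substitutions turns both identity types into the
  -- same raw term.
  simpa [witness, forces, famEx, pointwise, ex] using h5
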